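/- For every constant $k \ge 1$, computing the determinant of a square matrix whose underlying undirected graph has treewidth at most $k$ is $\mathsf{L}$-hard under first-order many-one reductions, already for $\{0,1\}$-matrices. Here the underlying undirected graph of a matrix $A = (a_{ij})$ has the row (= column) indices as vertices, and $i \neq j$ are adjacent iff $a_{ij} \neq 0$ or $a_{ji} \neq 0$. A first-order reduction maps a finite structure with universe $\{0,\dots,m-1\}$ to a $\{0,1\}$-matrix whose rows and columns are indexed by all $d$-tuples of elements of the universe ($d$ fixed), where a fixed first-order formula, which may use the relations and constants of the input structure and the numeric predicates $\le$, $+$, $\times$ and BIT, defines which entries are $1$. A binary word $w$ of length $n$ is viewed as the structure with universe $\{0,\dots,n\}$ and a unary predicate that marks the positions $i<n$ of $w$ carrying a one. The class $\mathsf{L}$ consists of the languages over $\{0,1\}$ decided by a deterministic Turing machine with a read-only input tape and $O(\log n)$ work tape cells. Precisely, let $k \ge 1$. Then: 1. For every language $A \in \mathsf{L}$ there is a first-order reduction $w \mapsto M_w$ from binary words to $\{0,1\}$-matrices such that for every word $w$ the underlying undirected graph of $M_w$ has treewidth at most $k$, and $\det M_w = 0$ if and only if $w \in A$. 2. Let $\mathsf{ORD}$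 be the problem of deciding, for a directed path $P$ on the vertices $\{0,\dots,n-1\}$ (given by its edge relation, the vertices occurring along $P$ in an arbitrary order and each exactly once) and two vertices $s,t$ of $P$, whether there is a (possibly trivial) directed path from $s$ to $t$ in $P$. There is a first-order reduction $(P,s,t) \mapsto M_{P,s,t}$ from $\mathsf{ORD}$ to $\{0,1\}$-matrices such that for every instance the underlying undirected graph of $M_{P,s,t}$ has treewidth at most $k$, and $\det M_{P,s,t} = 0$ if and only if $s$ reaches $t$ in $P$. -/

import Mathlib

namespace BTDet

/-! ### Treewidth -/

/-- A tree decomposition of an undirected graph, with a finite tree of bags. -/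
structure TreeDecomposition {V : Type} (G : SimpleGraph V) where
  Node : Type
  [nodeFintype : Fintype Node]
  tree : SimpleGraph Node
  isTree : tree.IsTree
  bag : Node → Finset V
  vertex_mem : ∀ v : V, ∃ i : Node, v ∈ bag i
  path_mem : ∀ (v : V) (i j : Node) (p : tree.Walk i j), p.IsPath →
    v ∈ bag i → v ∈ bag j → ∀ l ∈ p.support, v ∈ bag l
  edge_mem : ∀ u v : V, G.Adj u v → ∃ i : Node, u ∈ bag i ∧ v ∈ bag i

attribute [instance] TreeDecomposition.nodeFintype

/-- The width: the largest bag size minus one. -/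
def TreeDecomposition.width {V : Type} {G : SimpleGraph V} (D : TreeDecomposition G) : ℕ :=
  Finset.univ.sup fun i : D.Node => (D.bag i).card - 1

/-- The treewidth of a finite graph: the least width of a tree decomposition. (For a finite graph
the set is nonempty, since all vertices can be put into a single bag.) -/
noncomputable def treewidth {V : Type} [Finite V] (G : SimpleGraph V) : ℕ :=
  sInf {w : ℕ | ∃ D : TreeDecomposition G, D.width = w}

/-- The underlying undirected graph of a square matrix, viewed as the weighted adjacency matrix of
a directed graph: forget weights, directions and loops. -/
def underlyingGraph {ι : Type} (A : Matrix ι ι ℚ) : SimpleGraph ι where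
  Adj i j := i ≠ j ∧ (A i j ≠ 0 ∨ A j i ≠ 0)
  symm := ⟨fun _ _ h => ⟨h.1.symm, h.2.symm⟩⟩
  loopless := ⟨fun _ h => h.1 rfl⟩

/-! ### Deterministic logarithmic space -/

/-- What the input head can see: an end marker or an input bit. -/
inductive InputSymbol where
  | leftEnd
  | bit (b : Bool)
  | rightEnd

/-- Head movements. -/
inductive Move where
  | left
  | stay
  | right

/-- A deterministic Turing machine with a two-way read-only input tape and a one-way infinite
read-write work tape. A state `q` with `output q = some b` is a halting state with answer `b`. -/
structure Machine where
  State : Type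
  Symbol : Type
  [stateFintype : Fintype State]
  [symbolFintype : Fintype Symbol]
  start : State
  blank : Symbol
  output : State → Option Bool
  transition : State → InputSymbol → Symbol → State × Symbol × Move × Move

attribute [instance] Machine.stateFintype Machine.symbolFintype

/-- A configuration. Input position `0` is the left end marker, positions `1, …, n` hold the input
and position `n + 1` is the right end marker. -/
structure Machine.Config (M : Machine) where
  state : M.State
  inputPos : ℕ
  workPos : ℕ
  work : ℕ → M.Symbol

/-- The symbol at an input position. -/
def readInput (w : List Bool) : ℕ → InputSymbol
  | 0 => .leftEnd
  | p + 1 => match w[p]? with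
    | some b => .bit b
    | none => .rightEnd

/-- The effect of a head movement; a head at the left end of its tape cannot go further left. -/
def Move.apply : Move → ℕ → ℕ
  | .left, p => p - 1
  | .stay, p => p
  | .right, p => p + 1

/-- One computation step on input `w`; halting configurations do not change any more. The input
head never leaves the interval `[0, n + 1]`. -/
def Machine.step (M : Machine) (w : List Bool) (c : M.Config) : M.Config :=
  match M.output c.state with
  | some _ => c
  | none =>
    let r := M.transition c.state (readInput w c.inputPos) (c.work c.workPos)
    { state := r.1
      inputPos := min (r.2.2.1.apply c.inputPos) (w.length + 1)
      workPos := r.2.2.2.apply c.workPos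
      work := Function.update c.work c.workPos r.2.1 }

/-- The initial configuration: input head on the left end marker, blank work tape. -/
def Machine.init (M : Machine) : M.Config where
  state := M.start
  inputPos := 0
  workPos := 0
  work := fun _ => M.blank

/-- The configuration after `t` steps on input `w`. -/
def Machine.run (M : Machine) (w : List Bool) (t : ℕ) : M.Config :=
  (M.step w)^[t] M.init

/-- On every input the machine halts with the right answer. -/
def Machine.Decides (M : Machine) (A : Set (List Bool)) : Prop :=
  ∀ w : List Bool, ∃ t : ℕ, ∃ b : Bool,
    M.output (M.run w t).state = some b ∧ (b = true ↔ w ∈ A)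

/-- The machine visits only `O(log n)` cells of its work tape on inputs of length `n`. -/
def Machine.RunsInLogSpace (M : Machine) : Prop :=
  ∃ c : ℕ, ∀ (w : List Bool) (t : ℕ), (M.run w t).workPos < c * (Nat.log 2 w.length + 1)

/-- The complexity class `L`. -/
def ClassL : Set (Set (List Bool)) :=
  {A | ∃ M : Machine, M.Decides A ∧ M.RunsInLogSpace}

/-! ### First-order reductions -/

/-- The numeric predicates of first-order logic over finite ordered structures. -/
inductive NumericRel : ℕ → Type where
  | le : NumericRel 2
  | plus : NumericRel 3
  | times : NumericRel 3
  | bit : NumericRel 2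

/-- The vocabulary of the numeric predicates. -/
def numericLanguage : FirstOrder.Language.{0, 0} where
  Functions := fun _ => Empty
  Relations := NumericRel

/-- The standard meaning of the numeric predicates on the universe `{0, …, m - 1}`: order, the
graphs of addition and multiplication, and `bit x j`: bit number `j` of `x` is one. -/
instance numericStructure (m : ℕ) : numericLanguage.Structure (Fin m) where
  funMap := fun f _ => Empty.elim f
  RelMap := fun {_} r x => match r, x with
    | .le, x => (x 0 : ℕ) ≤ x 1
    | .plus, x => (x 0 : ℕ) + x 1 = x 2
    | .times, x => (x 0 : ℕ) * x 1 = x 2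
    | .bit, x => Nat.testBit (x 0) (x 1) = true

/-- A first-order reduction from structures of vocabulary `τ` to `{0,1}`-matrices: the rows and
columns of the output matrix are indexed by all `arity`-tuples of elements of the input, and a
fixed first-order formula over `τ` and the numeric predicates says which entries are one. -/
structure FOMatrixReduction (τ : FirstOrder.Language.{0, 0}) where
  arity : ℕ
  entry : (numericLanguage.sum τ).Formula (Fin arity ⊕ Fin arity)

open Classical in
/-- The matrix that a first-order reduction produces on an input structure with universe
`{0, …, m - 1}`. -/
noncomputable def FOMatrixReduction.output {τ : FirstOrder.Language.{0, 0}} (R : FOMatrixReduction τ) {m : ℕ}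
    (S : τ.Structure (Fin m)) :
    Matrix (Fin R.arity → Fin m) (Fin R.arity → Fin m) ℚ :=
  letI := S
  fun x y => if R.entry.Realize (Sum.elim x y) then 1 else 0

/-! ### Binary words as structures -/

/-- The only symbol of the vocabulary of binary words. -/
inductive WordRel : ℕ → Type where
  | one : WordRel 1

/-- The vocabulary of binary words: one unary predicate. -/
def wordLanguage : FirstOrder.Language.{0, 0} where
  Functions := fun _ => Empty
  Relations := WordRel

/-- The word `w` of length `n` as a structure with universe `{0, …, n}`: the predicate holds at the
positions `i < n` that carry a one; the element `n` marks the end (so that the empty word also has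
a nonempty universe). -/
@[reducible] def wordStructure (w : List Bool) : wordLanguage.Structure (Fin (w.length + 1)) where
  funMap := fun f _ => Empty.elim f
  RelMap := fun {_} r x => match r, x with
    | .one, x => w[(x 0 : ℕ)]? = some true

/-! ### The problem ORD -/

/-- An instance of ORD: a directed path on the vertices `0, …, n - 1` (visited in an arbitrary
order, given by its edge relation), and two vertices. -/
structure OrdInstance where
  n : ℕ
  edge : Fin n → Fin n → Prop
  isPath : ∃ v : Fin n ≃ Fin n, ∀ i j : Fin n, edge (v i) (v j) ↔ (j : ℕ) = i + 1
  s : Fin n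
  t : Fin n

/-- The question of ORD: is there a (possibly trivial) directed path from `s` to `t`? -/
def OrdInstance.Reaches (I : OrdInstance) : Prop :=
  Relation.ReflTransGen I.edge I.s I.t

/-- The constant symbols of the vocabulary of ORD. -/
inductive OrdFun : ℕ → Type where
  | s : OrdFun 0
  | t : OrdFun 0

/-- The relation symbol of the vocabulary of ORD. -/
inductive OrdRel : ℕ → Type where
  | edge : OrdRel 2

/-- The vocabulary of ORD: an edge relation and two constants. -/
def ordLanguage : FirstOrder.Language.{0, 0} where
  Functions := OrdFun
  Relations := OrdRel

/-- An instance of ORD as a structure. -/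
@[reducible] def OrdInstance.toStructure (I : OrdInstance) : ordLanguage.Structure (Fin I.n) where
  funMap := fun {_} f _ => match f with
    | .s => I.s
    | .t => I.t
  RelMap := fun {_} r x => match r, x with
    | .edge, x => I.edge (x 0) (x 1)

/-! ### Hardness -/

/-- Computing the determinant of matrices of treewidth at most `k` is `L`-hard: every language in
`L` has a first-order many-one reduction, all of whose outputs are matrices of treewidth at most
`k`, such that membership is equivalent to the vanishing of the determinant. -/
def DetLHard (k : ℕ) : Prop :=
  ∀ A ∈ ClassL, ∃ R : FOMatrixReduction wordLanguage, ∀ w : List Bool,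
    treewidth (underlyingGraph (R.output (wordStructure w))) ≤ k ∧
      ((R.output (wordStructure w)).det = 0 ↔ w ∈ A)

/-- ORD has a first-order many-one reduction to computing the determinant of matrices of treewidth
at most `k`: the determinant is zero iff `s` reaches `t`. -/
def OrdReducesToDet (k : ℕ) : Prop :=
  ∃ R : FOMatrixReduction ordLanguage, ∀ I : OrdInstance,
    treewidth (underlyingGraph (R.output I.toStructure)) ≤ k ∧
      ((R.output I.toStructure).det = 0 ↔ I.Reaches)

end BTDet

/-!
Reachability in a deterministic graph that is graded (each edge raises the rank by one) is expressed
by the determinant of a forest-shaped matrix, and logarithmic-space computations and paths are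
presented as such graphs by first-order formulas.

**The matrix.** Let `E` be the edge relation, `F` its adjacency matrix and `B = 1 + F`. Splitting
each vertex into an out-copy and an in-copy leads to the symmetric matrix `[[D_T, B], [Bᵀ, D_s]]`,
where `D_T` and `D_s` are the diagonal indicators of the targets and of the source. Since `B` is
unitriangular and its inverse has the entries `±1` along the unique path that leaves `s`, the
determinant is, up to sign, `1` minus the number of targets reached from `s`; this number is `0` or
`1` when the targets are sinks. The formal argument avoids the inverse and looks at the kernel
(`reachMatrix_det_eq_zero`, `reachMatrix_det_ne_zero`). The underlying graph joins an in-copy to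
the out-copy of the same vertex, and an out-copy to the in-copy of its only successor. It is a
forest, and loops do not count, so the treewidth is at most one (`treewidth_le_one_of_parent`).
Whatever is definable in first-order logic as a graph of this kind on tuples thus reduces to the
determinant (`exists_reduction_of_def`).

**`ORD`.** Deleting the edges that leave `t` makes `t` a sink; the position on the path is the rank.

**Logarithmic space.** A configuration is a tuple of numbers below `m = n + 1`: a bounded number of
coordinates for the finite control and the head positions, and numbers whose bits hold the work
tape. Each such number provides `log₂ m` bits, so boundedly many suffice, and with the numeric
predicate BIT the successor relation is first-order (`def_step`). The graph consists of
configurations together with a clock, a tuple that advances in lexicographic order. The clock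
provides the rank, and it runs long enough for the machine to halt, as configurations do not repeat
before that. The accepting configurations are the targets.
-/

namespace BTDet

/-! ### Forests have treewidth at most one -/

/-- A finite graph all of whose edges lead from a vertex to its unique parent, where parents have
larger rank, is a forest, so its treewidth is at most one. The tree of the decomposition consists
of the vertices themselves and an additional root `none` above all vertices without a parent; the
bag of a vertex holds the vertex and its parent. -/
theorem treewidth_le_one_of_parent {ι : Type} [Finite ι] (G : SimpleGraph ι)
    (parent : ι → Option ι) (rank : ι → ℕ)
    (hrank : ∀ x y, parent x = some y → rank x < rank y)
    (hG : ∀ x y, G.Adj x y → parent x = some y ∨ parent y = some x) : treewidth G ≤ 1 := by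
  classical
  have := Fintype.ofFinite ι
  let T : SimpleGraph (Option ι) := SimpleGraph.fromRel fun a b => ∃ x, a = some x ∧ b = parent x
  have hne : ∀ x, some x ≠ parent x := fun x h => (hrank x x h.symm).false
  have hadj : ∀ x, T.Adj (some x) (parent x) := fun x =>
    (SimpleGraph.fromRel_adj _ _ _).2 ⟨hne x, Or.inl ⟨x, rfl, rfl⟩⟩
  obtain ⟨N, hN⟩ : ∃ N, ∀ x, rank x ≤ N :=
    ⟨Finset.univ.sup rank, fun x => Finset.le_sup (f := rank) (Finset.mem_univ x)⟩
  have hroot : ∀ k x, N - rank x ≤ k → T.Reachable (some x) none := by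
    intro k
    induction k with
    | zero =>
      intro x hx
      have h := hadj x
      cases hp : parent x with
      | none => exact (hp ▸ h).reachable
      | some y => have := hrank x y hp; have := hN y; omega
    | succ k ih =>
      intro x hx
      have h := hadj x
      cases hp : parent x with
      | none => exact (hp ▸ h).reachable
      | some y =>
        have h1 := hrank x y hp
        have h2 := hN y
        exact (hp ▸ h).reachable.trans (ih y (by omega))
  have hroot' : ∀ a, T.Reachable a none := by
    intro a
    cases a with
    | none => exact SimpleGraph.Reachable.refl _
    | some x => exact hroot _ x le_rfl
  have hconn : T.Connected := by
    have : T.Preconnected := fun a b => (hroot' a).trans (hroot' b).symm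
    exact ⟨this⟩
  have htree : T.IsTree := by
    rw [SimpleGraph.isTree_iff_connected_and_card]
    refine ⟨hconn, le_antisymm ?_ hconn.card_vert_le_card_edgeSet_add_one⟩
    have hsub : T.edgeSet ⊆ Set.range fun x : ι => s(some x, parent x) := by
      intro e
      induction e using Sym2.ind with
      | _ a b =>
        intro h
        obtain ⟨-, ⟨x, rfl, rfl⟩ | ⟨x, rfl, rfl⟩⟩ :=
          (SimpleGraph.fromRel_adj _ _ _).1 (T.mem_edgeSet.1 h)
        · exact ⟨x, rfl⟩
        · exact ⟨x, Sym2.eq_swap⟩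
    have h1 : Nat.card T.edgeSet ≤ Nat.card (Set.range fun x : ι => s(some x, parent x)) :=
      Nat.card_mono (Set.toFinite _) hsub
    have h2 : Nat.card (Set.range fun x : ι => s(some x, parent x)) ≤ Nat.card ι :=
      Finite.card_range_le _
    rw [Finite.card_option]
    omega
  let bag : Option ι → Finset ι := fun a => a.elim ∅ fun x => insert x (parent x).toFinset
  have hbag : ∀ v a, v ∈ bag a ↔ a = some v ∨ ∃ x, a = some x ∧ parent x = some v := by
    rintro v (_ | x)
    · simp [bag]
    · simp [bag, eq_comm]
  -- A bag containing `v` is at the node `v` or at one of its neighbours.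
  have hstar : ∀ v a, v ∈ bag a → ∃ q : T.Walk a (some v), ∀ l ∈ q.support, v ∈ bag l := by
    intro v a ha
    rcases (hbag v a).1 ha with rfl | ⟨x, rfl, hx⟩
    · exact ⟨.nil, by simpa using ha⟩
    · refine ⟨(SimpleGraph.Adj.toWalk (hx ▸ hadj x)), ?_⟩
      intro l hl
      simp only [SimpleGraph.Walk.support_cons, SimpleGraph.Walk.support_nil,
        List.mem_cons, List.not_mem_nil, or_false] at hl
      rcases hl with rfl | rfl
      · exact ha
      · exact (hbag v _).2 (Or.inl rfl)
  let D : TreeDecomposition G :=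
    { Node := Option ι
      tree := T
      isTree := htree
      bag := bag
      vertex_mem := fun v => ⟨some v, (hbag v _).2 (Or.inl rfl)⟩
      path_mem := by
        intro v i j p hp hi hj l hl
        obtain ⟨q, hq⟩ := hstar v i hi
        obtain ⟨r, hr⟩ := hstar v j hj
        have hpe : p = (q.append r.reverse).bypass :=
          (htree.existsUnique_path i j).unique hp (SimpleGraph.Walk.bypass_isPath _)
        rw [hpe] at hl
        have hl' := SimpleGraph.Walk.support_bypass_subset_support _ hl
        rw [SimpleGraph.Walk.mem_support_append_iff] at hl'
        rcases hl' with h | h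
        · exact hq l h
        · exact hr l (by simpa using h)
      edge_mem := by
        intro u v h
        rcases hG u v h with h | h
        · exact ⟨some u, (hbag _ _).2 (Or.inl rfl), (hbag _ _).2 (Or.inr ⟨u, rfl, h⟩)⟩
        · exact ⟨some v, (hbag _ _).2 (Or.inr ⟨v, rfl, h⟩), (hbag _ _).2 (Or.inl rfl)⟩ }
  have hwidth : D.width ≤ 1 := by
    refine Finset.sup_le fun a _ => ?_
    change (bag a).card - 1 ≤ 1
    rcases a with _ | x
    · simp [bag]
    · have h1 := Finset.card_insert_le x (parent x).toFinset
      have h2 : (parent x).toFinset.card ≤ 1 := by cases parent x <;> simp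
      have h3 : (bag (some x)).card = (insert x (parent x).toFinset).card := rfl
      omega
  have hmem : D.width ∈ {w : ℕ | ∃ D : TreeDecomposition G, D.width = w} := ⟨D, rfl⟩
  exact (Nat.sInf_le hmem).trans hwidth

/-! ### A determinant that detects reachability -/

open Matrix in
open Classical in
/-- Each vertex `u` of the graph `E` has an out-copy `Sum.inl u` and an in-copy `Sum.inr u`. The
matrix is symmetric; it joins the out-copy of `u` to the in-copies of `u` and of its successors,
and has loops at the out-copies of the targets and at the in-copy of the source. -/
noncomputable def reachMatrix {V : Type} (E : V → V → Prop) (T : V → Prop) (s : V) :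
    Matrix (V ⊕ V) (V ⊕ V) ℚ :=
  fromBlocks (diagonal fun u => if T u then 1 else 0)
    (1 + Matrix.of fun u v => if E u v then 1 else 0)
    (1 + Matrix.of fun u v => if E u v then 1 else 0)ᵀ
    (diagonal fun u => if u = s then 1 else 0)

section Determinant

variable {V : Type} [Fintype V] [DecidableEq V] {E : V → V → Prop} {T : V → Prop} {s : V}
  {rank : V → ℕ}

open Matrix in
open Classical in
/-- The kernel equations: one for each out-copy and one for each in-copy. -/
theorem reachMatrix_mulVec_eq_zero_iff (x y : V → ℚ) :
    reachMatrix E T s *ᵥ Sum.elim x y = 0 ↔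
      (∀ u, (if T u then x u else 0) + (y u + ∑ w, if E u w then y w else 0) = 0) ∧
      (∀ v, (x v + ∑ u, if E u v then x u else 0) + (if v = s then y v else 0) = 0) := by
  rw [reachMatrix, fromBlocks_mulVec, funext_iff, Sum.forall]
  simp only [Sum.elim_comp_inl, Sum.elim_comp_inr, Sum.elim_inl, Sum.elim_inr, Pi.add_apply,
    mulVec_diagonal, add_mulVec, transpose_add, transpose_one, one_mulVec, Pi.zero_apply]
  simp only [mulVec, dotProduct, of_apply, transpose_apply, ite_mul, one_mul, zero_mul]

open Matrix in
/-- If no target is reachable from the source, the kernel is trivial. The second components of a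
kernel vector vanish from the sinks backwards, the first ones from the sources forwards. -/
theorem reachMatrix_det_ne_zero (hrank : ∀ u v, E u v → rank v = rank u + 1)
    (hs : ∀ t, T t → ¬ Relation.ReflTransGen E s t) : (reachMatrix E T s).det ≠ 0 := by
  classical
  intro hdet
  obtain ⟨z, hz, hz0⟩ := exists_mulVec_eq_zero_iff.2 hdet
  obtain ⟨x, y, rfl⟩ : ∃ x y, z = Sum.elim x y := ⟨_, _, (Sum.elim_comp_inl_inr z).symm⟩
  obtain ⟨h1, h2⟩ := (reachMatrix_mulVec_eq_zero_iff x y).1 hz0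
  have hx : ∀ n v, rank v = n → ¬ Relation.ReflTransGen E s v → x v = 0 := by
    intro n
    induction n using Nat.strong_induction_on with
    | _ n ih =>
      intro v hn hv
      have hvs : v ≠ s := fun h => hv (h ▸ .refl)
      have h := h2 v
      rw [if_neg hvs, add_zero, Finset.sum_eq_zero, add_zero] at h
      · exact h
      · intro u _
        split_ifs with hu
        · exact ih (rank u) (by have := hrank u v hu; omega) u rfl fun h' => hv (h'.tail hu)
        · rfl
  obtain ⟨N, hN⟩ : ∃ N, ∀ x, rank x ≤ N :=
    ⟨Finset.univ.sup rank, fun x => Finset.le_sup (f := rank) (Finset.mem_univ x)⟩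
  have hy : ∀ n u, N - rank u = n → y u = 0 := by
    intro n
    induction n using Nat.strong_induction_on with
    | _ n ih =>
      intro u hn
      have h := h1 u
      have hT : (if T u then x u else 0) = 0 := by
        split_ifs with hT
        · exact hx _ u rfl (hs u hT)
        · rfl
      rw [hT, zero_add, Finset.sum_eq_zero, add_zero] at h
      · exact h
      · intro w _
        split_ifs with hw
        · have h3 := hrank u w hw
          have h4 := hN w
          exact ih (N - rank w) (by omega) w rfl
        · rfl
  have hx' : ∀ n v, rank v = n → x v = 0 := by
    intro n
    induction n using Nat.strong_induction_on with
    | _ n ih =>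
      intro v hn
      have h := h2 v
      rw [hy _ v rfl, ite_self, add_zero, Finset.sum_eq_zero, add_zero] at h
      · exact h
      · intro u _
        split_ifs with hu
        · exact ih (rank u) (by have := hrank u v hu; omega) u rfl
        · rfl
  apply hz
  funext v
  rcases v with v | v
  · exact hx' _ v rfl
  · exact hy _ v rfl

open Matrix in
/-- If a target `t` is reachable from the source, then a kernel vector is given by signs on the
out-copies of the vertices reachable from `s` and on the in-copies of those that reach `t`. -/
theorem reachMatrix_det_eq_zero (hfun : ∀ u v w, E u v → E u w → v = w)
    (hrank : ∀ u v, E u v → rank v = rank u + 1) (hsink : ∀ t v, T t → ¬ E t v)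
    {t : V} (ht : T t) (hst : Relation.ReflTransGen E s t) : (reachMatrix E T s).det = 0 := by
  classical
  have hru : Relator.RightUnique E := fun u v w => hfun u v w
  have hle : ∀ {u v}, Relation.ReflTransGen E u v → rank u ≤ rank v := by
    intro u v h
    induction h with
    | refl => rfl
    | tail _ h ih => have := hrank _ _ h; omega
  have hend : ∀ {u v}, T u → Relation.ReflTransGen E u v → u = v := by
    intro u v hu h
    rcases h.cases_head with h | ⟨w, h, -⟩
    · exact h
    · exact (hsink u w hu h).elim
  let σ : V → ℚ := fun v => (-1) ^ rank v
  let x : V → ℚ := fun v => if Relation.ReflTransGen E s v then σ v else 0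
  let y : V → ℚ := fun v => if Relation.ReflTransGen E v t then - σ v else 0
  have hσ : ∀ u v, E u v → σ v = - σ u := by
    intro u v h
    simp only [σ, hrank u v h, pow_succ, mul_neg, mul_one]
  have hxs : x s = σ s := if_pos .refl
  refine exists_mulVec_eq_zero_iff.1 ⟨Sum.elim x y, ?_, ?_⟩
  · intro h
    have := congrFun h (Sum.inl s)
    simp [hxs, σ] at this
  refine (reachMatrix_mulVec_eq_zero_iff x y).2 ⟨fun u => ?_, fun v => ?_⟩
  · by_cases hut : Relation.ReflTransGen E u t
    · rcases hut.cases_head with rfl | ⟨w, huw, hwt⟩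
      · rw [Finset.sum_eq_zero]
        · simp [x, y, ht, hst, Relation.ReflTransGen.refl]
        · intro w _
          exact if_neg (hsink _ w ht)
      · rw [if_neg fun h => hsink u w h huw, Finset.sum_eq_single w]
        · simp [y, hut, hwt, huw, hσ u w huw]
        · intro w' _ hw'
          exact if_neg fun h => hw' (hfun u _ _ h huw)
        · simp
    · rw [Finset.sum_eq_zero]
      · have : (if T u then x u else 0) = 0 := by
          split_ifs with hT
          · refine if_neg fun hsu => hut ?_
            rcases Relation.ReflTransGen.total_of_right_unique hru hsu hst with h | h
            · exact h
            · rw [hend ht h]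
          · rfl
        rw [this]
        simp [y, hut]
      · intro w _
        split_ifs with hw
        · exact if_neg fun h => hut (.head hw h)
        · rfl
  · by_cases hsv : Relation.ReflTransGen E s v
    · rcases hsv.cases_tail with rfl | ⟨u, hsu, huv⟩
      · rw [Finset.sum_eq_zero]
        · simp [x, y, hst, Relation.ReflTransGen.refl]
        · intro u _
          split_ifs with hu
          · refine if_neg fun h => ?_
            have h3 := hle h
            have h4 := hrank _ _ hu
            omega
          · rfl
      · have hvs : v ≠ s := by
          rintro rfl
          have h3 := hle hsu
          have h4 := hrank _ _ huv
          omega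
        rw [if_neg hvs, Finset.sum_eq_single u]
        · simp [x, hsv, hsu, huv, hσ u v huv]
        · intro u' _ hne
          split_ifs with hu'
          -- Two reachable predecessors lie on one path and have equal rank.
          · refine if_neg fun h => hne ?_
            have h3 := hrank _ _ hu'
            have h4 := hrank _ _ huv
            rcases Relation.ReflTransGen.total_of_right_unique hru h hsu with h | h
            · rcases h.cases_head with h | ⟨w, h5, h6⟩
              · exact h
              · have h7 := hle h6; have h8 := hrank _ _ h5; omega
            · rcases h.cases_head with h | ⟨w, h5, h6⟩
              · exact h.symm
              · have h7 := hle h6; have h8 := hrank _ _ h5; omega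
          · rfl
        · simp
    · have hvs : v ≠ s := fun h => hsv (h ▸ .refl)
      rw [if_neg hvs, Finset.sum_eq_zero]
      · simp [x, hsv]
      · intro u _
        split_ifs with hu
        · exact if_neg fun h => hsv (h.tail hu)
        · rfl

end Determinant

/-! ### The reachability matrix on a larger index set -/

/-- The entries of the matrix `reachMatrix` when its indices are embedded in a larger set by `o`
(out-copies) and `i` (in-copies). The remaining indices are isolated and carry a loop. -/
def ReachEntry {ι V : Type} (o i : V → ι) (E : V → V → Prop) (T : V → Prop) (s : V)
    (x y : ι) : Prop :=
  (∃ u v, x = o u ∧ y = i v ∧ (u = v ∨ E u v)) ∨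
  (∃ u v, y = o u ∧ x = i v ∧ (u = v ∨ E u v)) ∨
  (x = y ∧ ((∃ u, x = o u ∧ T u) ∨ x = i s ∨ ¬ ((∃ u, x = o u) ∨ ∃ u, x = i u)))

section Embedding

variable {ι V : Type} [Fintype ι] {o i : V → ι} {E : V → V → Prop}
  {T : V → Prop} {s : V} {rank : V → ℕ} {M : Matrix ι ι ℚ}

open Classical in
theorem det_eq_zero_iff_of_reachEntry [DecidableEq ι] (hinj : Function.Injective (Sum.elim o i))
    (hfun : ∀ u v w, E u v → E u w → v = w)
    (hrank : ∀ u v, E u v → rank v = rank u + 1) (hsink : ∀ t v, T t → ¬ E t v)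
    (hM : ∀ x y, M x y = if ReachEntry o i E T s x y then 1 else 0) :
    M.det = 0 ↔ ∃ t, T t ∧ Relation.ReflTransGen E s t := by
  have : Finite (V ⊕ V) := Finite.of_injective _ hinj
  have : Finite V := Finite.of_injective (Sum.inl : V → V ⊕ V) Sum.inl_injective
  have := Fintype.ofFinite V
  let e : (V ⊕ V) ⊕ ((Set.range (Sum.elim o i))ᶜ : Set ι) ≃ ι :=
    ((Equiv.ofInjective _ hinj).sumCongr (Equiv.refl _)).trans (Equiv.Set.sumCompl _)
  have hel : ∀ a, e (Sum.inl a) = Sum.elim o i a := fun a => rfl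
  have her : ∀ a, e (Sum.inr a) = a := fun a => rfl
  have ho : ∀ u v, o u = o v ↔ u = v := fun u v =>
    ⟨fun h => Sum.inl_injective (hinj (a₁ := Sum.inl u) (a₂ := Sum.inl v) h), fun h => h ▸ rfl⟩
  have hi : ∀ u v, i u = i v ↔ u = v := fun u v =>
    ⟨fun h => Sum.inr_injective (hinj (a₁ := Sum.inr u) (a₂ := Sum.inr v) h), fun h => h ▸ rfl⟩
  have hoi : ∀ u v, o u ≠ i v := fun u v h =>
    Sum.inl_ne_inr (hinj (a₁ := Sum.inl u) (a₂ := Sum.inr v) h)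
  have hio : ∀ u v, i u ≠ o v := fun u v h => hoi v u h.symm
  have hE : ∀ u, ¬ E u u := fun u h => by have := hrank u u h; omega
  have hJ : ∀ (a : ((Set.range (Sum.elim o i))ᶜ : Set ι)) u, (a : ι) ≠ o u ∧ (a : ι) ≠ i u :=
    fun a u => ⟨fun h => a.2 ⟨Sum.inl u, h.symm⟩, fun h => a.2 ⟨Sum.inr u, h.symm⟩⟩
  have hJ' : ∀ (a : ((Set.range (Sum.elim o i))ᶜ : Set ι)) u, o u ≠ (a : ι) ∧ i u ≠ (a : ι) :=
    fun a u => ⟨(hJ a u).1.symm, (hJ a u).2.symm⟩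
  have hblocks : M.submatrix e e = Matrix.fromBlocks (reachMatrix E T s) 0 0 1 := by
    ext (( u | u ) | a) ((v | v) | b)
    · by_cases h : u = v <;>
        simp [hel, hM, ReachEntry, reachMatrix, ho, hoi, h]
    · by_cases h : u = v <;>
        simp [hel, hM, ReachEntry, reachMatrix, ho, hi, hoi, hio, h, hE]
    · simp [hel, her, hM, ReachEntry, hJ, hJ']
    · by_cases h : u = v
      · simp [hel, hM, ReachEntry, reachMatrix, ho, hi, hoi, hio, h, hE]
      · simp [hel, hM, ReachEntry, reachMatrix, ho, hi, hoi, hio, h, Ne.symm h]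
    · by_cases h : u = v <;>
        simp [hel, hM, ReachEntry, reachMatrix, hi, hio, h]
    · simp [hel, her, hM, ReachEntry, hJ, hJ']
    · simp [hel, her, hM, ReachEntry, hJ]
    · simp [hel, her, hM, ReachEntry, hJ]
    · simp [her, hM, ReachEntry, hJ, Matrix.one_apply, Subtype.ext_iff]
  rw [← Matrix.det_submatrix_equiv_self e, hblocks, Matrix.det_fromBlocks_zero₂₁, Matrix.det_one,
    mul_one]
  refine ⟨fun h => ?_, fun ⟨t, ht, hst⟩ => reachMatrix_det_eq_zero hfun hrank hsink ht hst⟩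
  by_contra hne
  exact reachMatrix_det_ne_zero hrank (fun t ht hst => hne ⟨t, ht, hst⟩) h

open Classical in
/-- The parent of an in-copy is the out-copy of the same vertex; the parent of an out-copy is the
in-copy of the successor. -/
theorem treewidth_le_one_of_reachEntry (hinj : Function.Injective (Sum.elim o i))
    (hfun : ∀ u v w, E u v → E u w → v = w)
    (hrank : ∀ u v, E u v → rank v = rank u + 1)
    (hM : ∀ x y, M x y = if ReachEntry o i E T s x y then 1 else 0) :
    treewidth (underlyingGraph M) ≤ 1 := by
  obtain ⟨f, hf⟩ : ∃ f : V → Option V, ∀ u v, f u = some v ↔ E u v := by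
    refine ⟨fun u => if h : ∃ v, E u v then some h.choose else none, fun u v => ?_⟩
    dsimp only
    split_ifs with h
    · rw [Option.some_inj]
      exact ⟨fun h' => h' ▸ h.choose_spec, fun h' => hfun u _ _ h.choose_spec h'⟩
    · simpa using fun h' => h ⟨v, h'⟩
  let P : V ⊕ V → Option (V ⊕ V) := Sum.elim (fun u => (f u).map Sum.inr) fun u => some (Sum.inl u)
  let ρ : V ⊕ V → ℕ := Sum.elim (fun u => 2 * rank u + 1) fun u => 2 * rank u
  have hP : ∀ a b, P a = some b → ρ a < ρ b := by
    rintro (u | u) b hb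
    · obtain ⟨v, hv, rfl⟩ := Option.map_eq_some_iff.1 hb
      have := hrank u v ((hf u v).1 hv)
      simp only [ρ, Sum.elim_inl, Sum.elim_inr]
      omega
    · obtain rfl : Sum.inl u = b := Option.some_inj.1 hb
      simp only [ρ, Sum.elim_inl, Sum.elim_inr]
      omega
  let Q : ι → Option ι :=
    Function.extend (Sum.elim o i) (fun a => (P a).map (Sum.elim o i)) fun _ => none
  have hQ : ∀ a, Q (Sum.elim o i a) = (P a).map (Sum.elim o i) := fun a => hinj.extend_apply _ _ a
  have hρ : ∀ a, Function.extend (Sum.elim o i) ρ 0 (Sum.elim o i a) = ρ a :=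
    fun a => hinj.extend_apply _ _ a
  have key : ∀ u v, (u = v ∨ E u v) → Q (o u) = some (i v) ∨ Q (i v) = some (o u) := by
    rintro u v (rfl | h)
    · exact Or.inr (hQ (Sum.inr u))
    · left
      have := hQ (Sum.inl u)
      simp only [P, Sum.elim_inl, (hf u v).2 h] at this
      exact this
  refine treewidth_le_one_of_parent _ Q (Function.extend (Sum.elim o i) ρ 0) ?_ ?_
  · intro x y hxy
    by_cases hx : ∃ a, Sum.elim o i a = x
    · obtain ⟨a, rfl⟩ := hx
      rw [hQ] at hxy
      obtain ⟨b, hb, rfl⟩ := Option.map_eq_some_iff.1 hxy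
      rw [hρ, hρ]
      exact hP a b hb
    · simp only [Q, Function.extend_apply' _ _ _ hx, reduceCtorEq] at hxy
  · have hsymm : ∀ x y, x ≠ y → ReachEntry o i E T s x y → Q x = some y ∨ Q y = some x := by
      rintro x y hne (⟨u, v, rfl, rfl, h⟩ | ⟨u, v, rfl, rfl, h⟩ | ⟨h, -⟩)
      · exact key u v h
      · exact (key u v h).symm
      · exact (hne h).elim
    rintro x y ⟨hne, h | h⟩
    · refine hsymm x y hne ?_
      by_contra h'
      exact h (by rw [hM, if_neg h'])
    · refine (hsymm y x hne.symm ?_).symm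
      by_contra h'
      exact h (by rw [hM, if_neg h'])

end Embedding

/-! ### First-order definable families of predicates -/

section Definability

open FirstOrder Language

variable {τ : FirstOrder.Language.{0, 0}} {𝓘 : Type} {m : 𝓘 → ℕ} {S : ∀ i, τ.Structure (Fin (m i))}
  {α β : Type}

/-- A family of predicates on assignments of the variables `α`, one for each structure of the
family `S`, is definable if one formula over `τ` and the numeric predicates defines all of them. -/
def Def (S : ∀ i, τ.Structure (Fin (m i))) (P : ∀ i, (α → Fin (m i)) → Prop) : Prop :=
  ∃ φ : (numericLanguage.sum τ).Formula α, ∀ i v, (letI := S i; φ.Realize v) ↔ P i v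

namespace Def

variable {P Q : ∀ i, (α → Fin (m i)) → Prop}

theorem congr (h : Def S P) (hPQ : ∀ i v, Q i v ↔ P i v) : Def S Q := by
  obtain ⟨φ, hφ⟩ := h
  exact ⟨φ, fun i v => (hφ i v).trans (hPQ i v).symm⟩

theorem not (h : Def S P) : Def S fun i v => ¬ P i v := by
  obtain ⟨φ, hφ⟩ := h
  refine ⟨∼φ, fun i v => ?_⟩
  simp only [Formula.realize_not, hφ]

theorem and (h : Def S P) (h' : Def S Q) : Def S fun i v => P i v ∧ Q i v := by
  obtain ⟨φ, hφ⟩ := h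
  obtain ⟨ψ, hψ⟩ := h'
  refine ⟨φ ⊓ ψ, fun i v => ?_⟩
  simp only [Formula.realize_inf, hφ, hψ]

theorem or (h : Def S P) (h' : Def S Q) : Def S fun i v => P i v ∨ Q i v := by
  obtain ⟨φ, hφ⟩ := h
  obtain ⟨ψ, hψ⟩ := h'
  refine ⟨φ ⊔ ψ, fun i v => ?_⟩
  simp only [Formula.realize_sup, hφ, hψ]

theorem imp (h : Def S P) (h' : Def S Q) : Def S fun i v => P i v → Q i v :=
  (h.not.or h').congr fun _ _ => imp_iff_not_or

theorem iff (h : Def S P) (h' : Def S Q) : Def S fun i v => (P i v ↔ Q i v) :=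
  ((h.imp h').and (h'.imp h)).congr fun _ _ => iff_iff_implies_and_implies

theorem const (p : Prop) : Def S fun i (_ : α → Fin (m i)) => p := by
  by_cases hp : p
  · exact ⟨⊤, fun i v => by simp [hp]⟩
  · exact ⟨⊥, fun i v => by simp [hp]⟩

theorem existsFin {κ : Type} [Finite κ] {R : κ → ∀ i, (α → Fin (m i)) → Prop}
    (h : ∀ k, Def S (R k)) : Def S fun i v => ∃ k, R k i v := by
  choose φ hφ using h
  refine ⟨Formula.iSup φ, fun i v => ?_⟩
  simp only [Formula.realize_iSup, hφ]

theorem forallFin {κ : Type} [Finite κ] {R : κ → ∀ i, (α → Fin (m i)) → Prop}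
    (h : ∀ k, Def S (R k)) : Def S fun i v => ∀ k, R k i v := by
  choose φ hφ using h
  refine ⟨Formula.iInf φ, fun i v => ?_⟩
  simp only [Formula.realize_iInf, hφ]

/-- Renaming (and identifying) variables. -/
theorem comap {P : ∀ i, (β → Fin (m i)) → Prop} (h : Def S P) (g : β → α) :
    Def S fun i v => P i (v ∘ g) := by
  obtain ⟨φ, hφ⟩ := h
  refine ⟨φ.relabel g, fun i v => ?_⟩
  simp only [Formula.realize_relabel, hφ]

theorem existsTuple [Finite β] {R : ∀ i, (α → Fin (m i)) → (β → Fin (m i)) → Prop}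
    (h : Def S fun i (v : α ⊕ β → Fin (m i)) => R i (v ∘ Sum.inl) (v ∘ Sum.inr)) :
    Def S fun i v => ∃ w, R i v w := by
  obtain ⟨φ, hφ⟩ := h
  refine ⟨Formula.iExs β φ, fun i v => ?_⟩
  let := S i
  rw [Formula.realize_iExs]
  exact exists_congr fun w => hφ i (Sum.elim v w)

theorem forallTuple [Finite β] {R : ∀ i, (α → Fin (m i)) → (β → Fin (m i)) → Prop}
    (h : Def S fun i (v : α ⊕ β → Fin (m i)) => R i (v ∘ Sum.inl) (v ∘ Sum.inr)) :
    Def S fun i v => ∀ w, R i v w :=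
  (existsTuple (R := fun i v w => ¬ R i v w) h.not).not.congr fun _ _ => not_exists_not.symm

theorem existsElem {R : ∀ i, (α → Fin (m i)) → Fin (m i) → Prop}
    (h : Def S fun i (v : α ⊕ Unit → Fin (m i)) => R i (v ∘ Sum.inl) (v (Sum.inr ()))) :
    Def S fun i v => ∃ x, R i v x :=
  (existsTuple (R := fun i v (w : Unit → Fin (m i)) => R i v (w ())) h).congr fun _ _ =>
    ⟨fun ⟨x, hx⟩ => ⟨fun _ => x, hx⟩, fun ⟨w, hw⟩ => ⟨w (), hw⟩⟩

theorem forallElem {R : ∀ i, (α → Fin (m i)) → Fin (m i) → Prop}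
    (h : Def S fun i (v : α ⊕ Unit → Fin (m i)) => R i (v ∘ Sum.inl) (v (Sum.inr ()))) :
    Def S fun i v => ∀ x, R i v x :=
  (existsElem (R := fun i v x => ¬ R i v x) h.not).not.congr fun _ _ => not_exists_not.symm

theorem eq (a b : α) : Def S fun _ v => v a = v b :=
  ⟨Term.equal (.var a) (.var b), fun i v => by simp [Formula.realize_equal]⟩

theorem rel {k : ℕ} (r : τ.Relations k) (a : Fin k → α) :
    Def S fun i v => (S i).RelMap r fun j => v (a j) :=
  ⟨Relations.formula (L := numericLanguage.sum τ) (Sum.inr r) fun j => .var (a j),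
    fun _ _ => Iff.rfl⟩

theorem constant (c : τ.Constants) (a : α) :
    Def S fun i v => v a = (S i).funMap c ![] :=
  ⟨Term.equal (.var a) (Constants.term (L := numericLanguage.sum τ) (Sum.inr c)),
    fun i v => by
      let := S i
      refine Formula.realize_equal.trans (Eq.congr_right ?_)
      exact congrArg ((S i).funMap c) (Subsingleton.elim _ _)⟩

theorem numeric {k : ℕ} (r : NumericRel k) (a : Fin k → α) :
    Def S fun i v => (numericStructure (m i)).RelMap r fun j => v (a j) :=
  ⟨Relations.formula (L := numericLanguage.sum τ) (Sum.inl r) fun j => .var (a j),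
    fun _ _ => Iff.rfl⟩

theorem le (a b : α) : Def S fun _ v => v a ≤ v b :=
  (numeric .le ![a, b]).congr fun _ _ => Iff.rfl

theorem lt (a b : α) : Def S fun _ v => v a < v b :=
  (le b a).not.congr fun _ _ => not_le.symm

theorem testBit (a b : α) : Def S fun _ v => Nat.testBit (v a) (v b) = true :=
  (numeric .bit ![a, b]).congr fun _ _ => Iff.rfl

theorem isZero (a : α) : Def S fun _ v => (v a : ℕ) = 0 := by
  refine (forallElem (R := fun i v x => v a ≤ x) (le (Sum.inl a) (Sum.inr ()))).congr fun i v => ?_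
  refine ⟨fun h x => Fin.le_def.2 (by omega), fun h => ?_⟩
  have := Fin.le_def.1 (h ⟨0, (v a).pos⟩)
  exact Nat.le_zero.1 this

theorem isLast (a : α) : Def S fun i v => (v a : ℕ) + 1 = m i := by
  refine (forallElem (R := fun i v x => x ≤ v a) (le (Sum.inr ()) (Sum.inl a))).congr fun i v => ?_
  refine ⟨fun h x => Fin.le_def.2 (by omega), fun h => ?_⟩
  have h1 := Fin.le_def.1 (h ⟨m i - 1, by have := (v a).pos; omega⟩)
  have h2 := (v a).isLt
  simp only at h1
  omega

theorem succ (a b : α) : Def S fun _ v => (v a : ℕ) + 1 = v b := by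
  refine ((lt a b).and (forallElem (R := fun i v x => ¬ (v a < x ∧ x < v b))
    ((lt (Sum.inl a) (Sum.inr ())).and (lt (Sum.inr ()) (Sum.inl b))).not)).congr fun i v => ?_
  constructor
  · intro h
    refine ⟨Fin.lt_def.2 (by omega), fun x hx => ?_⟩
    have h1 := Fin.lt_def.1 hx.1
    have h2 := Fin.lt_def.1 hx.2
    omega
  · rintro ⟨h1, h2⟩
    have h1 := Fin.lt_def.1 h1
    by_contra hne
    exact h2 ⟨v a + 1, by omega⟩ ⟨Fin.lt_def.2 (by simp), Fin.lt_def.2 (by simp only; omega)⟩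

/-- The covering relation of the lexicographic order on tuples. -/
theorem lexCovBy {e : ℕ} (a b : Fin e → α) :
    Def S fun _ v => toLex (fun j => v (a j)) ⋖ toLex (fun j => v (b j)) := by
  have hlt : ∀ {γ : Type} (a b : Fin e → γ),
      Def S fun i (v : γ → Fin (m i)) => toLex (fun j => v (a j)) < toLex (fun j => v (b j)) :=
    fun a b => (existsFin (R := fun k i v => (∀ j, j < k → v (a j) = v (b j)) ∧ v (a k) < v (b k))
      fun k => (forallFin fun j => (const (j < k)).imp (eq (a j) (b j))).and
        (lt (a k) (b k))).congr fun _ _ => Iff.rfl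
  refine ((hlt a b).and (forallTuple (β := Fin e) (R := fun i v c =>
    ¬ (toLex (fun j => v (a j)) < toLex c ∧ toLex c < toLex (fun j => v (b j))))
    ((hlt (fun j => Sum.inl (a j)) Sum.inr).and
      (hlt Sum.inr fun j => Sum.inl (b j))).not)).congr fun i v => ?_
  refine and_congr Iff.rfl ?_
  exact ⟨fun h c hc => h hc.1 hc.2, fun h c h1 h2 => h (ofLex c) ⟨h1, h2⟩⟩

end Def

end Definability

/-! ### Reductions from definable reachability -/

section Reduction

open FirstOrder

variable {τ : FirstOrder.Language.{0, 0}} {𝓘 : Type} {m : 𝓘 → ℕ}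
  {S : ∀ i, τ.Structure (Fin (m i))} {Var : Type}

/-- Reachability of a sink from a source in a definable deterministic graded graph on tuples reduces
to the determinant. The copies of a tuple carry an additional coordinate, which is the least
element for the out-copy and the greatest element for the in-copy. These differ only if there are
at least two elements; a universe with one element admits a single `1 × 1` matrix, whose entry is
prescribed by the fixed answer `K`. -/
theorem exists_reduction_of_def [Finite Var] (hm : ∀ i, 0 < m i)
    {E : ∀ i, (Var → Fin (m i)) → (Var → Fin (m i)) → Prop} {T : ∀ i, (Var → Fin (m i)) → Prop}
    {s : ∀ i, Var → Fin (m i)} (K : Prop)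
    (hE : Def S fun i (v : Var ⊕ Var → Fin (m i)) => E i (v ∘ Sum.inl) (v ∘ Sum.inr))
    (hT : Def S T) (hs : Def S fun i v => v = s i)
    (hfun : ∀ i, 2 ≤ m i → ∀ u v w, E i u v → E i u w → v = w)
    (hrank : ∀ i, 2 ≤ m i → ∃ rank : (Var → Fin (m i)) → ℕ, ∀ u v, E i u v → rank v = rank u + 1)
    (hsink : ∀ i, 2 ≤ m i → ∀ t v, T i t → ¬ E i t v) :
    ∃ R : FOMatrixReduction τ, ∀ i, treewidth (underlyingGraph (R.output (S i))) ≤ 1 ∧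
      (m i = 1 → ((R.output (S i)).det = 0 ↔ K)) ∧
      (2 ≤ m i → ((R.output (S i)).det = 0 ↔
        ∃ t, T i t ∧ Relation.ReflTransGen (E i) (s i) t)) := by
  classical
  have := Fintype.ofFinite Var
  let ε : Fin (Fintype.card (Option Var)) ≃ Option Var := (Fintype.equivFin (Option Var)).symm
  set a := Fintype.card (Option Var)
  let j₀ : Fin a := ε.symm none
  let c : Var → Fin a := fun x => ε.symm (some x)
  let o : ∀ i, (Var → Fin (m i)) → (Fin a → Fin (m i)) := fun i u j =>
    (ε j).elim ⟨0, hm i⟩ u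
  let o' : ∀ i, (Var → Fin (m i)) → (Fin a → Fin (m i)) := fun i u j =>
    (ε j).elim ⟨m i - 1, Nat.sub_lt (hm i) one_pos⟩ u
  have hO : ∀ i x u, x = o i u ↔ (x j₀ : ℕ) = 0 ∧ u = x ∘ c := by
    intro i x u
    constructor
    · rintro rfl
      exact ⟨by simp [o, j₀], by funext; simp [o, c]⟩
    · rintro ⟨h, rfl⟩
      funext j
      obtain ⟨b, rfl⟩ := ε.symm.surjective j
      cases b with
      | none => exact Fin.ext (by simpa [o] using h)
      | some b => simp [o, c]
  have hI : ∀ i x u, x = o' i u ↔ (x j₀ : ℕ) + 1 = m i ∧ u = x ∘ c := by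
    intro i x u
    have hmi := hm i
    constructor
    · rintro rfl
      exact ⟨by simp only [o', j₀, Equiv.apply_symm_apply, Option.elim_none]; omega,
        by funext; simp [o', c]⟩
    · rintro ⟨h, rfl⟩
      funext j
      obtain ⟨b, rfl⟩ := ε.symm.surjective j
      cases b with
      | none =>
        refine Fin.ext ?_
        simp only [o', Equiv.apply_symm_apply, Option.elim_none]
        exact Nat.eq_sub_of_add_eq h
      | some b => simp [o', c]
  have hinj : ∀ i, 2 ≤ m i → Function.Injective (Sum.elim (o i) (o' i)) := by
    intro i hi
    rintro (u | u) (v | v) h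
    · have h1 := ((hO i _ u).1 rfl).2
      exact congrArg Sum.inl (h1.trans ((hO i _ v).1 h).2.symm)
    · have h1 := ((hO i _ u).1 rfl).1
      have h2 := ((hI i _ v).1 h).1
      simp only [Sum.elim_inl] at h2
      omega
    · have h1 := ((hI i _ u).1 rfl).1
      have h2 := ((hO i _ v).1 h).1
      simp only [Sum.elim_inr] at h2
      omega
    · have h1 := ((hI i _ u).1 rfl).2
      exact congrArg Sum.inr (h1.trans ((hI i _ v).1 h).2.symm)
  have hzero : ∀ b, Def S fun i (v : Fin a ⊕ Fin a → Fin (m i)) => (v b : ℕ) = 0 := Def.isZero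
  have hlast : ∀ b, Def S fun i (v : Fin a ⊕ Fin a → Fin (m i)) => (v b : ℕ) + 1 = m i :=
    Def.isLast
  have hlink : ∀ p q : Fin a → Fin a ⊕ Fin a, Def S fun i v =>
      (v (p j₀) : ℕ) = 0 ∧ (v (q j₀) : ℕ) + 1 = m i ∧
        ((∀ x, v (p (c x)) = v (q (c x))) ∨ E i (fun x => v (p (c x))) fun x => v (q (c x))) :=
    fun p q => (hzero _).and ((hlast _).and ((Def.forallFin fun x => Def.eq _ _).or
      (hE.comap (Sum.elim (fun x => p (c x)) fun x => q (c x)))))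
  have hentry : Def S fun i (v : Fin a ⊕ Fin a → Fin (m i)) =>
      ReachEntry (o i) (o' i) (E i) (T i) (s i) (v ∘ Sum.inl) (v ∘ Sum.inr) := by
    refine ((hlink Sum.inl Sum.inr).or ((hlink Sum.inr Sum.inl).or
      ((Def.forallFin fun j => Def.eq (Sum.inl j) (Sum.inr j)).and
        (((hzero (Sum.inl j₀)).and (hT.comap fun x => Sum.inl (c x))).or
          (((hlast (Sum.inl j₀)).and (hs.comap fun x => Sum.inl (c x))).or
            ((hzero (Sum.inl j₀)).or (hlast (Sum.inl j₀))).not))))).congr fun i v => ?_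
    unfold ReachEntry
    simp only [hO, hI, funext_iff]
    refine or_congr ?_ (or_congr ?_ (and_congr Iff.rfl (or_congr ?_ (or_congr ?_ ?_))))
    · constructor
      · rintro ⟨u, w, ⟨h1, h2⟩, ⟨h3, h4⟩, h5⟩
        obtain rfl := funext h2
        obtain rfl := funext h4
        exact ⟨h1, h3, h5⟩
      · rintro ⟨h1, h3, h5⟩
        exact ⟨_, _, ⟨h1, fun _ => rfl⟩, ⟨h3, fun _ => rfl⟩, h5⟩
    · constructor
      · rintro ⟨u, w, ⟨h1, h2⟩, ⟨h3, h4⟩, h5⟩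
        obtain rfl := funext h2
        obtain rfl := funext h4
        exact ⟨h1, h3, h5⟩
      · rintro ⟨h1, h3, h5⟩
        exact ⟨_, _, ⟨h1, fun _ => rfl⟩, ⟨h3, fun _ => rfl⟩, h5⟩
    · constructor
      · rintro ⟨u, ⟨h1, h2⟩, h3⟩
        obtain rfl := funext h2
        exact ⟨h1, h3⟩
      · rintro ⟨h1, h3⟩
        exact ⟨_, ⟨h1, fun _ => rfl⟩, h3⟩
    · exact and_congr Iff.rfl ⟨fun h x => (h x).symm, fun h x => (h x).symm⟩
    · refine not_congr (or_congr ?_ ?_)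
      · exact ⟨fun ⟨u, h, _⟩ => h, fun h => ⟨_, h, fun _ => rfl⟩⟩
      · exact ⟨fun ⟨u, h, _⟩ => h, fun h => ⟨_, h, fun _ => rfl⟩⟩
  have hone : Def S fun i (_ : Fin a ⊕ Fin a → Fin (m i)) => m i = 1 := by
    refine (Def.forallElem (R := fun i v x => (x : ℕ) = 0) (Def.isZero (Sum.inr ()))).congr ?_
    intro i v
    refine ⟨fun h x => by omega, fun h => ?_⟩
    have h1 := hm i
    have h2 := h ⟨m i - 1, by omega⟩
    simp only at h2
    omega
  obtain ⟨φ, hφ⟩ := (hone.and (Def.const (¬ K))).or (hone.not.and hentry)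
  refine ⟨⟨a, φ⟩, fun i => ?_⟩
  have hM : ∀ x y, FOMatrixReduction.output ⟨a, φ⟩ (S i) x y =
      if (m i = 1 ∧ ¬ K) ∨ (¬ m i = 1 ∧ ReachEntry (o i) (o' i) (E i) (T i) (s i) x y)
        then 1 else 0 := fun x y => if_congr (hφ i (Sum.elim x y)) rfl rfl
  generalize FOMatrixReduction.output ⟨a, φ⟩ (S i) = M at hM ⊢
  rcases Nat.lt_or_ge (m i) 2 with hmi | hmi
  · have h1 : m i = 1 := by have := hm i; omega
    have hsub : Subsingleton (Fin (m i)) := by rw [h1]; infer_instance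
    refine ⟨?_, fun _ => ?_, fun h => by omega⟩
    · exact treewidth_le_one_of_parent _ (fun _ => none) (fun _ => 0) (by simp)
        fun x y h => (h.1 (Subsingleton.elim x y)).elim
    · rw [Matrix.det_eq_elem_of_subsingleton M fun _ => ⟨0, hm i⟩, hM]
      simp [h1]
  · have h1 : m i ≠ 1 := by omega
    simp only [h1, false_and, not_false_eq_true, true_and, false_or] at hM
    obtain ⟨rank, hr⟩ := hrank i hmi
    refine ⟨?_, fun h => absurd h h1, fun _ => ?_⟩
    · exact treewidth_le_one_of_reachEntry (hinj i hmi) (hfun i hmi) hr hM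
    · exact det_eq_zero_iff_of_reachEntry (hinj i hmi) (hfun i hmi) hr (hsink i hmi) hM

end Reduction

/-! ### The reduction from `ORD` -/

/-- The edges that leave `t` are deleted, which does not affect whether `t` is reachable. The
position along the path grades the remaining graph. -/
theorem ordReducesToDet_one : OrdReducesToDet 1 := by
  let S : ∀ I : OrdInstance, ordLanguage.Structure (Fin I.n) := fun I => I.toStructure
  have hedge : ∀ {α : Type} (a b : α), Def S fun I v => I.edge (v a) (v b) :=
    fun a b => (Def.rel (τ := ordLanguage) (S := S) OrdRel.edge ![a, b]).congr fun _ _ => Iff.rfl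
  have hs : ∀ {α : Type} (a : α), Def S fun I v => v a = I.s := fun a =>
    Def.constant (τ := ordLanguage) (S := S) OrdFun.s a
  have ht : ∀ {α : Type} (a : α), Def S fun I v => v a = I.t := fun a =>
    Def.constant (τ := ordLanguage) (S := S) OrdFun.t a
  have hpath : ∀ I : OrdInstance, ∃ pos : Fin I.n ≃ Fin I.n,
      ∀ u v, I.edge u v ↔ (pos v : ℕ) = pos u + 1 := by
    intro I
    obtain ⟨v, hv⟩ := I.isPath
    exact ⟨v.symm, fun a b => by simpa using hv (v.symm a) (v.symm b)⟩
  obtain ⟨R, hR⟩ := exists_reduction_of_def (S := S) (Var := Unit) (fun I => I.s.pos)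
    (E := fun I u v => I.edge (u ()) (v ()) ∧ u () ≠ I.t) (T := fun I u => u () = I.t)
    (s := fun I _ => I.s) True
    ((hedge _ _).and (ht _).not) (ht _)
    ((hs ()).congr fun I v => funext_iff.trans ⟨fun h => h (), fun h _ => h⟩)
    (fun I _ u v w h1 h2 => by
      obtain ⟨pos, hp⟩ := hpath I
      have h1 := (hp _ _).1 h1.1
      have h2 := (hp _ _).1 h2.1
      funext x
      exact pos.injective (Fin.ext (h1.trans h2.symm)))
    (fun I _ => by
      obtain ⟨pos, hp⟩ := hpath I
      exact ⟨fun u => pos (u ()), fun u v h => (hp _ _).1 h.1⟩)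
    (fun I _ t v h h' => h'.2 h)
  refine ⟨R, fun I => ⟨(hR I).1, ?_⟩⟩
  have hpos := I.s.pos
  rcases Nat.lt_or_ge I.n 2 with hn | hn
  -- With a single vertex, `s = t` is reached trivially.
  · have hn1 : I.n = 1 := by omega
    have hst : I.s = I.t := Fin.ext (by omega)
    refine ((hR I).2.1 hn1).trans ⟨fun _ => ?_, fun _ => trivial⟩
    rw [OrdInstance.Reaches, hst]
  · refine ((hR I).2.2 hn).trans ⟨?_, fun h => ?_⟩
    · rintro ⟨t, ht, h⟩
      have h : Relation.ReflTransGen I.edge I.s (t ()) :=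
        h.lift (fun u : Unit → Fin I.n => u ()) fun u v h => h.1
      exact (ht ▸ h : Relation.ReflTransGen I.edge I.s I.t)
    · refine ⟨fun _ => I.t, rfl, ?_⟩
      unfold OrdInstance.Reaches at h
      generalize I.s = u at h
      induction h using Relation.ReflTransGen.head_induction_on with
      | refl => exact .refl
      | @head u v huv _ ih =>
        by_cases hu : u = I.t
        · rw [hu]
        · exact .head ⟨huv, hu⟩ ih

/-! ### Encoding configurations as tuples -/

/-- The indicator of `b = a`, complemented where `b = z`; thus `z` itself is encoded by zeros. -/
def Mark {α : Type} (z a b : α) : Prop := ¬ (b = a ↔ b = z)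

theorem not_mark_self {α : Type} (z b : α) : ¬ Mark z z b := fun h => h Iff.rfl

theorem mark_injective {α : Type} {z a a' : α} (h : ∀ b, Mark z a b ↔ Mark z a' b) : a = a' := by
  have := h a
  unfold Mark at this
  tauto

section Encoding

variable {M : Machine} {C : ℕ} [NeZero C] {m : ℕ} {w : List Bool}

/-- The finite part of a configuration: the state, a flag that is off if the input head is on the
left end marker, and the residue of the work head position modulo `C`. -/
abbrev Control (M : Machine) (C : ℕ) : Type := M.State × Bool × Fin C

/-- The coordinates of an encoded configuration. The input head is at position `0` if the flag is
off and at `input + 1` otherwise. The work head is at `offset * C + b`, with `b` in the finite part.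
The cell `p * C + b` is encoded by the bits number `p` of the coordinates `tape b a`. -/
inductive CVar (M : Machine) (C : ℕ) : Type where
  | control (φ : Control M C)
  | input
  | offset
  | tape (b : Fin C) (a : M.Symbol)

instance : Finite (CVar M C) := by
  refine Finite.of_surjective
    (fun x : (Control M C ⊕ Fin C × M.Symbol) ⊕ Bool => match x with
      | .inl (.inl φ) => CVar.control φ
      | .inl (.inr (b, a)) => .tape b a
      | .inr true => .input
      | .inr false => .offset) ?_
  rintro (φ | _ | _ | ⟨b, a⟩)
  · exact ⟨.inl (.inl φ), rfl⟩
  · exact ⟨.inr true, rfl⟩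
  · exact ⟨.inr false, rfl⟩
  · exact ⟨.inl (.inr (b, a)), rfl⟩

instance : Finite InputSymbol := by
  refine Finite.of_surjective (fun x : Option (Option Bool) => match x with
    | none => InputSymbol.leftEnd
    | some none => .rightEnd
    | some (some b) => .bit b) ?_
  rintro (_ | b | _)
  · exact ⟨none, rfl⟩
  · exact ⟨some (some b), rfl⟩
  · exact ⟨some none, rfl⟩

/-- The coordinates `control` of `z` encode `φ`: marked ones hold the greatest element, the other
ones the least. -/
def IsControl (z : CVar M C → Fin m) (φ : Control M C) : Prop :=
  ∀ ψ, (Mark (M.start, false, 0) φ ψ → (z (.control ψ) : ℕ) + 1 = m) ∧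
    (¬ Mark (M.start, false, 0) φ ψ → (z (.control ψ) : ℕ) = 0)

/-- The symbol `a` is encoded at the current offset, for the residue `b`. -/
def Reads (z : CVar M C → Fin m) (b : Fin C) (a : M.Symbol) : Prop :=
  ∀ a', Nat.testBit (z (.tape b a')) (z .offset) = true ↔ Mark M.blank a a'

/-- The input symbol under the head. -/
def inputSymbol (w : List Bool) (fl : Bool) (p : ℕ) : InputSymbol :=
  if fl then readInput w (p + 1) else .leftEnd

/-- A move of the input head between encoded positions. On words of length `m - 1` the right end
marker is at position `m`, where the head is stopped; a flag that is off requires the coordinate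
`0`, which makes the encoding of positions unique. -/
def InputMove (m : ℕ) (mv : Move) (fl fl' : Bool) (p p' : ℕ) : Prop :=
  (fl = false → p = 0) ∧ (fl' = false → p' = 0) ∧
    p' + fl'.toNat = min (mv.apply (p + fl.toNat)) m

/-- A move of the work head between encoded positions. Since the residue modulo `C` is the lower
digit, the offset changes at most by one and the number of available offsets plays no role. -/
def WorkMove (mv : Move) (b b' : Fin C) (o o' : ℕ) : Prop :=
  o' * C + b' = mv.apply (o * C + b)

/-- The successor relation on encoded configurations. The control parts, the symbols that are read
and the moves range over finite sets that depend on the machine only, so that a formula can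
distinguish all cases. -/
def Step (w : List Bool) (z z' : CVar M C → Fin m) : Prop :=
  ∃ (φ φ' : Control M C) (a : M.Symbol) (σ : InputSymbol),
    (M.output φ.1 = none ∧ φ'.1 = (M.transition φ.1 σ a).1) ∧
    IsControl z φ ∧ IsControl z' φ' ∧ Reads z φ.2.2 a ∧
    inputSymbol w φ.2.1 (z .input) = σ ∧
    InputMove m (M.transition φ.1 σ a).2.2.1 φ.2.1 φ'.2.1 (z .input) (z' .input) ∧
    WorkMove (M.transition φ.1 σ a).2.2.2 φ.2.2 φ'.2.2 (z .offset) (z' .offset) ∧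
    ∀ (b : Fin C) (a' : M.Symbol) (p : Fin m), Nat.testBit (z' (.tape b a')) p = true ↔
      (b = φ.2.2 ∧ p = z .offset) ∧ Mark M.blank (M.transition φ.1 σ a).2.1 a' ∨
      ¬ (b = φ.2.2 ∧ p = z .offset) ∧ Nat.testBit (z (.tape b a')) p = true

/-- The tuple `z` encodes the configuration `c`. -/
def Encodes (z : CVar M C → Fin m) (c : M.Config) : Prop :=
  ∃ φ : Control M C, IsControl z φ ∧ φ.1 = c.state ∧ (φ.2.1 = false → (z .input : ℕ) = 0) ∧
    (z .input : ℕ) + φ.2.1.toNat = c.inputPos ∧ (z .offset : ℕ) * C + φ.2.2 = c.workPos ∧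
    ∀ (b : Fin C) (a : M.Symbol) (p : ℕ),
      Nat.testBit (z (.tape b a)) p = true ↔ Mark M.blank (c.work (p * C + b)) a

theorem mul_add_inj {o o' : ℕ} {b b' : Fin C} (h : o * C + b = o' * C + b') : o = o' ∧ b = b' := by
  have hC : 0 < C := Nat.pos_of_ne_zero (NeZero.ne C)
  have h1 := congrArg (· / C) h
  have h2 := congrArg (· % C) h
  simp only [Nat.add_comm (_ * C), Nat.add_mul_div_right _ _ hC,
    Nat.add_mul_mod_self_right, Nat.div_eq_of_lt b.isLt, Nat.div_eq_of_lt b'.isLt,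
    Nat.mod_eq_of_lt b.isLt, Nat.mod_eq_of_lt b'.isLt, zero_add] at h1 h2
  exact ⟨h1, Fin.ext h2⟩

theorem IsControl.unique (hm : 2 ≤ m) {z : CVar M C → Fin m} {φ φ' : Control M C}
    (h : IsControl z φ) (h' : IsControl z φ') : φ = φ' := by
  refine mark_injective (z := (M.start, false, (0 : Fin C))) fun ψ => ?_
  by_contra hne
  have h1 := h ψ
  have h2 := h' ψ
  by_cases h3 : Mark (M.start, false, (0 : Fin C)) φ ψ
  · have h4 : ¬ Mark (M.start, false, (0 : Fin C)) φ' ψ := by tauto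
    have := h1.1 h3
    have := h2.2 h4
    omega
  · have h4 : Mark (M.start, false, (0 : Fin C)) φ' ψ := by
      by_contra h4
      exact hne (iff_of_false h3 h4)
    have := h1.2 h3
    have := h2.1 h4
    omega

theorem IsControl.congr {z z' : CVar M C → Fin m} {φ : Control M C}
    (h : IsControl z φ) (h' : IsControl z' φ) (ψ : Control M C) :
    z (.control ψ) = z' (.control ψ) := by
  refine Fin.ext ?_
  have h1 := h ψ
  have h2 := h' ψ
  by_cases h3 : Mark (M.start, false, (0 : Fin C)) φ ψ
  · have := h1.1 h3
    have := h2.1 h3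
    omega
  · have := h1.2 h3
    have := h2.2 h3
    omega

/-- Only the bits at positions below `m` matter in a universe of `m` elements. -/
theorem fin_eq_of_testBit {x y : Fin m}
    (h : ∀ p : Fin m, Nat.testBit x p = true ↔ Nat.testBit y p = true) : x = y := by
  refine Fin.ext (Nat.eq_of_testBit_eq fun p => ?_)
  rcases Nat.lt_or_ge p m with hp | hp
  · exact Bool.eq_iff_iff.2 (h ⟨p, hp⟩)
  · have h2 : ∀ x : Fin m, Nat.testBit x p = false := fun x =>
      Nat.testBit_lt_two_pow (x.isLt.trans_le (hp.trans Nat.lt_two_pow_self.le))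
    rw [h2, h2]

theorem Step.unique (hm : 2 ≤ m) {z z₁ z₂ : CVar M C → Fin m} (h₁ : Step w z z₁)
    (h₂ : Step w z z₂) : z₁ = z₂ := by
  obtain ⟨φ, φ₁, a, σ, ⟨-, hq₁⟩, hφ, hφ₁, ha, hσ, hi₁, hw₁, ht₁⟩ := h₁
  obtain ⟨ψ, φ₂, a₂, σ₂, ⟨-, hq₂⟩, hψ, hφ₂, ha₂, hσ₂, hi₂, hw₂, ht₂⟩ := h₂
  obtain rfl := hφ.unique hm hψ
  obtain rfl : a = a₂ := mark_injective fun b => (ha b).symm.trans (ha₂ b)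
  obtain rfl := hσ.symm.trans hσ₂
  have hin : φ₁.2.1 = φ₂.2.1 ∧ z₁ .input = z₂ .input := by
    obtain ⟨-, h1, h2⟩ := hi₁
    obtain ⟨-, h3, h4⟩ := hi₂
    rw [← h4] at h2
    rw [Fin.ext_iff]
    cases h5 : φ₁.2.1 <;> cases h6 : φ₂.2.1 <;> simp only [h5, h6, Bool.toNat_true,
      Bool.toNat_false, forall_const, reduceCtorEq, false_and, true_and] at h1 h2 h3 ⊢ <;> omega
  obtain ⟨ho, hb⟩ := mul_add_inj (hw₁.trans hw₂.symm)
  obtain rfl : φ₁ = φ₂ := Prod.ext (hq₁.trans hq₂.symm) (Prod.ext hin.1 hb)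
  funext x
  cases x with
  | control ψ => exact hφ₁.congr hφ₂ ψ
  | input => exact hin.2
  | offset => exact Fin.ext ho
  | tape b a' => exact fin_eq_of_testBit fun p => (ht₁ b a' p).trans (ht₂ b a' p).symm

theorem Encodes.injective (hm : 2 ≤ m) {z : CVar M C → Fin m} {c c' : M.Config}
    (h : Encodes z c) (h' : Encodes z c') : c = c' := by
  obtain ⟨φ, hφ, hq, -, hi, hw, ht⟩ := h
  obtain ⟨ψ, hψ, hq', -, hi', hw', ht'⟩ := h'
  obtain rfl := hφ.unique hm hψ
  obtain ⟨q, i, p, f⟩ := c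
  obtain ⟨q', i', p', f'⟩ := c'
  simp only at hq hq' hi hi' hw hw' ht ht'
  subst hq hq' hi hi' hw hw'
  congr 1
  funext j
  have hC : 0 < C := Nat.pos_of_ne_zero (NeZero.ne C)
  have hj : j / C * C + ((⟨j % C, Nat.mod_lt _ hC⟩ : Fin C) : ℕ) = j := Nat.div_add_mod' j C
  rw [← hj]
  exact mark_injective fun b => (ht _ b _).symm.trans (ht' _ b _)

/-- The relation `Step` simulates the machine. -/
theorem Encodes.step {z z' : CVar M C → Fin (w.length + 1)} {c : M.Config} (h : Encodes z c)
    (h' : Encodes z' (M.step w c)) (hc : M.output c.state = none) : Step w z z' := by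
  obtain ⟨φ, hφ, hq, hf, hi, hw, ht⟩ := h
  obtain ⟨φ', hφ', hq', hf', hi', hw', ht'⟩ := h'
  simp only [Machine.step, hc] at hq' hi' hw' ht'
  have hσ : inputSymbol w φ.2.1 (z .input) = readInput w c.inputPos := by
    rw [← hi]
    cases h : φ.2.1
    · simp [inputSymbol, hf h, readInput]
    · simp [inputSymbol]
  refine ⟨φ, φ', c.work c.workPos, readInput w c.inputPos, ⟨hq ▸ hc, by rw [hq', hq]⟩, hφ, hφ', ?_,
    hσ, ?_, ?_, ?_⟩
  · intro a'
    rw [ht, hw]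
  · rw [hq]
    exact ⟨hf, hf', by rw [hi', hi]⟩
  · rw [hq, WorkMove, hw', hw]
  · intro b a' p
    rw [ht', ht, hq]
    by_cases hbp : b = φ.2.2 ∧ p = z .offset
    · obtain ⟨rfl, rfl⟩ := hbp
      rw [hw, Function.update_self]
      simp
    · have hne : (p : ℕ) * C + b ≠ c.workPos := by
        rw [← hw]
        exact fun h => hbp ⟨(mul_add_inj h).2, Fin.ext (mul_add_inj h).1⟩
      rw [Function.update_of_ne hne]
      simp [hbp]

theorem Encodes.not_step (hm : 2 ≤ m) {z z' : CVar M C → Fin m} {c : M.Config} (h : Encodes z c)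
    (hc : M.output c.state ≠ none) : ¬ Step w z z' := by
  rintro ⟨φ, -, -, -, ⟨hn, -⟩, hφ, -⟩
  obtain ⟨ψ, hψ, hq, -⟩ := h
  obtain rfl := hφ.unique hm hψ
  exact hc (hq ▸ hn)

theorem encodes_init {z : CVar M C → Fin m} (hz : ∀ x, (z x : ℕ) = 0) : Encodes z M.init := by
  refine ⟨(M.start, false, 0), fun ψ => ⟨fun h => (not_mark_self _ _ h).elim, fun _ => hz _⟩, rfl,
    fun _ => hz _, ?_, ?_, fun b a p => ?_⟩
  · simp [hz, Machine.init]
  · simp [hz, Machine.init]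
  · simp [hz, Machine.init, not_mark_self]

/-- A configuration fits into the universe `{0, …, m - 1}` if its work tape is blank from the cell
`C * log₂ m` on: the numbers with fewer than `log₂ m` bits belong to the universe. -/
theorem exists_encodes (hm : 0 < m) {c : M.Config} (hi : c.inputPos ≤ m)
    (hw : c.workPos < C * Nat.log 2 m) (hb : ∀ j, C * Nat.log 2 m ≤ j → c.work j = M.blank) :
    ∃ z : CVar M C → Fin m, Encodes z c := by
  classical
  have hC : 0 < C := Nat.pos_of_ne_zero (NeZero.ne C)
  have hL : 2 ^ Nat.log 2 m ≤ m := Nat.pow_log_le_self 2 hm.ne'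
  have ho : c.workPos / C < Nat.log 2 m := Nat.div_lt_of_lt_mul hw
  have hLm : Nat.log 2 m < m := Nat.lt_two_pow_self.trans_le hL
  let φ : Control M C := (c.state, decide (c.inputPos ≠ 0), ⟨c.workPos % C, Nat.mod_lt _ hC⟩)
  let bits : Fin C → M.Symbol → ℕ := fun b a =>
    Nat.ofBits fun p : Fin (Nat.log 2 m) => decide (Mark M.blank (c.work (p * C + b)) a)
  let z : CVar M C → Fin m := fun x => match x with
    | .control ψ => if Mark (M.start, false, 0) φ ψ then ⟨m - 1, by omega⟩ else ⟨0, hm⟩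
    | .input => ⟨c.inputPos - 1, by omega⟩
    | .offset => ⟨c.workPos / C, by omega⟩
    | .tape b a => ⟨bits b a, (Nat.ofBits_lt_two_pow _).trans_le hL⟩
  refine ⟨z, φ, fun ψ => ⟨fun h => ?_, fun h => ?_⟩, rfl, fun h => ?_, ?_, ?_, fun b a p => ?_⟩
  · simp only [z, if_pos h]
    omega
  · simp only [z, if_neg h]
  · simp only [z]
    have : c.inputPos = 0 := by simpa [φ] using h
    omega
  · simp only [z, φ]
    by_cases h : c.inputPos = 0
    · simp [h]
    · simp only [ne_eq, h, not_false_eq_true, decide_true, Bool.toNat_true]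
      omega
  · exact Nat.div_add_mod' _ _
  · change Nat.testBit (bits b a) p = true ↔ _
    rcases Nat.lt_or_ge p (Nat.log 2 m) with hp | hp
    · simp [bits, Nat.testBit_ofBits_lt _ p hp]
    · rw [Nat.testBit_ofBits_ge _ p hp, hb]
      · simp [not_mark_self]
      · calc C * Nat.log 2 m ≤ C * p := Nat.mul_le_mul_left _ hp
          _ ≤ p * C + b := by rw [Nat.mul_comm]; exact Nat.le_add_right _ _

end Encoding

/-! ### Definability of the encoded computation -/

section StepDefinable

/-- The structures of all binary words. -/
abbrev words : ∀ w : List Bool, wordLanguage.Structure (Fin (w.length + 1)) :=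
  fun w => wordStructure w

variable {M : Machine} {C : ℕ} {α : Type}

theorem def_reads (b : Fin C) (a : M.Symbol) (z : CVar M C → α) :
    Def words fun _ v => Reads (fun x => v (z x)) b a :=
  Def.forallFin fun a' => (Def.testBit _ _).iff (Def.const (Mark M.blank a a'))

variable [NeZero C]

theorem def_isControl (φ : Control M C) (z : CVar M C → α) :
    Def words fun _ v => IsControl (fun x => v (z x)) φ :=
  Def.forallFin fun ψ => ((Def.const (Mark (M.start, false, 0) φ ψ)).imp (Def.isLast _)).and
    ((Def.const (Mark (M.start, false, 0) φ ψ)).not.imp (Def.isZero _))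

theorem def_inputSymbol (fl : Bool) (σ : InputSymbol) (p : α) :
    Def words fun w v => inputSymbol w fl (v p) = σ := by
  cases fl with
  | false => exact (Def.const (InputSymbol.leftEnd = σ)).congr fun w v => by simp [inputSymbol]
  | true =>
    have hone : Def words fun w (v : α → Fin (w.length + 1)) => w[(v p : ℕ)]? = some true :=
      (Def.rel (τ := wordLanguage) (S := words) WordRel.one fun _ => p).congr fun _ _ => Iff.rfl
    have hend : ∀ (w : List Bool) (x : Fin (w.length + 1)),
        (x : ℕ) + 1 = w.length + 1 ↔ w[(x : ℕ)]? = none := by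
      intro w x
      rw [List.getElem?_eq_none_iff]
      omega
    cases σ with
    | leftEnd =>
      refine (Def.const False).congr fun w v => ?_
      simp only [inputSymbol, if_true, readInput]
      split <;> simp
    | rightEnd =>
      refine (Def.isLast p).congr fun w v => ?_
      rw [hend]
      simp only [inputSymbol, if_true, readInput]
      split <;> simp_all
    | bit b =>
      cases b with
      | true =>
        refine hone.congr fun w v => ?_
        simp only [inputSymbol, if_true, readInput]
        split <;> simp_all
      | false =>
        refine (hone.not.and (Def.isLast p).not).congr fun w v => ?_
        rw [hend]
        simp only [inputSymbol, if_true, readInput]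
        split <;> simp_all

theorem def_inputMove (mv : Move) (fl fl' : Bool) (p p' : α) :
    Def words fun w v => InputMove (w.length + 1) mv fl fl' (v p) (v p') := by
  -- The cases are left, stay, right; for each of them, the flags are off/off,
  -- off/on, on/off, on/on.
  cases mv <;> cases fl <;> cases fl'
  · refine ((Def.isZero p).and (Def.isZero p')).congr fun w v => ?_
    simp only [InputMove, Move.apply, Bool.toNat_false, forall_const]
    omega
  · refine (Def.const False).congr fun w v => ?_
    simp only [InputMove, Move.apply, Bool.toNat_false, Bool.toNat_true, forall_const,
      reduceCtorEq, false_imp_iff, true_and, iff_false]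
    omega
  · refine ((Def.isZero p).and (Def.isZero p')).congr fun w v => ?_
    simp only [InputMove, Move.apply, Bool.toNat_false, Bool.toNat_true, forall_const,
      reduceCtorEq, false_imp_iff, true_and]
    omega
  · refine (Def.succ p' p).congr fun w v => ?_
    simp only [InputMove, Move.apply, Bool.toNat_true, reduceCtorEq, false_imp_iff, true_and]
    omega
  · refine ((Def.isZero p).and (Def.isZero p')).congr fun w v => ?_
    simp only [InputMove, Move.apply, Bool.toNat_false, forall_const]
    omega
  · refine (Def.const False).congr fun w v => ?_
    simp only [InputMove, Move.apply, Bool.toNat_false, Bool.toNat_true, forall_const,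
      reduceCtorEq, false_imp_iff, true_and, iff_false]
    omega
  · refine (Def.const False).congr fun w v => ?_
    simp only [InputMove, Move.apply, Bool.toNat_false, Bool.toNat_true, forall_const,
      reduceCtorEq, false_imp_iff, true_and, iff_false]
    omega
  · refine (Def.eq p p').congr fun w v => ?_
    simp only [InputMove, Move.apply, Bool.toNat_true, reduceCtorEq, false_imp_iff, true_and]
    omega
  · refine (Def.const False).congr fun w v => ?_
    simp only [InputMove, Move.apply, Bool.toNat_false, forall_const, iff_false]
    omega
  · refine ((Def.isZero p).and (Def.isZero p')).congr fun w v => ?_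
    simp only [InputMove, Move.apply, Bool.toNat_false, Bool.toNat_true, forall_const,
      reduceCtorEq, false_imp_iff, true_and]
    omega
  · refine (Def.const False).congr fun w v => ?_
    simp only [InputMove, Move.apply, Bool.toNat_false, Bool.toNat_true, forall_const,
      reduceCtorEq, false_imp_iff, true_and, iff_false]
    omega
  · refine ((Def.succ p p').or ((Def.isLast p).and (Def.eq p p'))).congr fun w v => ?_
    simp only [InputMove, Move.apply, Bool.toNat_true, reduceCtorEq, false_imp_iff, true_and]
    omega

/-- Equality of the mixed numbers `o * C + b`, with the residue given as a natural number. -/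
theorem mul_add_eq_iff {o o' b b' : ℕ} (hb : b < C) (hb' : b' < C) :
    o' * C + b' = o * C + b ↔ o' = o ∧ b' = b := by
  refine ⟨fun h => ?_, fun ⟨h1, h2⟩ => by rw [h1, h2]⟩
  have := mul_add_inj (b := ⟨b', hb'⟩) (b' := ⟨b, hb⟩) h
  simpa using this

theorem def_workMove (mv : Move) (b b' : Fin C) (p p' : α) :
    Def words fun _ v => WorkMove mv b b' (v p : ℕ) (v p') := by
  have hC : 0 < C := Nat.pos_of_ne_zero (NeZero.ne C)
  have hb := b.isLt
  have hb' := b'.isLt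
  cases mv
  · rcases Nat.eq_zero_or_pos b with h0 | h0
    · refine (((Def.isZero p).and ((Def.isZero p').and (Def.const ((b' : ℕ) = 0)))).or
        ((Def.succ p' p).and (Def.const ((b' : ℕ) = C - 1)))).congr fun w v => ?_
      simp only [WorkMove, Move.apply, h0]
      rcases Nat.eq_zero_or_pos (v p : ℕ) with hp | hp
      · rw [hp]
        have := mul_add_eq_iff (o := 0) (o' := v p') hC hb'
        simp only [zero_mul, add_zero, Nat.zero_sub] at this ⊢
        rw [this, true_and]
        omega
      · obtain ⟨o, ho⟩ : ∃ o, (v p : ℕ) = o + 1 := ⟨v p - 1, by omega⟩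
        have h1 : (v p : ℕ) * C + 0 - 1 = o * C + (C - 1) := by
          rw [ho, Nat.succ_mul]
          omega
        rw [h1, mul_add_eq_iff (by omega) hb']
        omega
    · refine ((Def.eq p' p).and (Def.const ((b' : ℕ) = b - 1))).congr fun w v => ?_
      simp only [WorkMove, Move.apply]
      rw [Nat.add_sub_assoc h0, mul_add_eq_iff (by omega) hb', Fin.ext_iff]
  · refine ((Def.eq p' p).and (Def.const ((b' : ℕ) = b))).congr fun w v => ?_
    simp only [WorkMove, Move.apply]
    rw [mul_add_eq_iff hb hb', Fin.ext_iff]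
  · rcases Nat.lt_or_ge (b + 1) C with h0 | h0
    · refine ((Def.eq p' p).and (Def.const ((b' : ℕ) = b + 1))).congr fun w v => ?_
      simp only [WorkMove, Move.apply]
      rw [Nat.add_assoc, mul_add_eq_iff h0 hb', Fin.ext_iff]
    · refine ((Def.succ p p').and (Def.const ((b' : ℕ) = 0))).congr fun w v => ?_
      have h1 : (v p : ℕ) * C + b + 1 = (v p + 1) * C + 0 := by
        rw [Nat.succ_mul]
        omega
      simp only [WorkMove, Move.apply]
      rw [h1, mul_add_eq_iff hC hb']
      omega

theorem def_step (z z' : CVar M C → α) :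
    Def words fun w v => Step w (fun x => v (z x)) fun x => v (z' x) :=
  Def.existsFin fun φ => Def.existsFin fun φ' => Def.existsFin fun a => Def.existsFin fun σ =>
    (Def.const _).and <| (def_isControl φ z).and <| (def_isControl φ' z').and <|
    (def_reads φ.2.2 a z).and <| (def_inputSymbol φ.2.1 σ _).and <|
    (def_inputMove _ φ.2.1 φ'.2.1 _ _).and <| (def_workMove _ φ.2.2 φ'.2.2 _ _).and <|
    Def.forallFin fun b => Def.forallFin fun a' => by
      have hb : Def words fun (w : List Bool) (v : α ⊕ Unit → Fin (w.length + 1)) =>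
          b = φ.2.2 ∧ v (.inr ()) = v (.inl (z .offset)) := (Def.const _).and (Def.eq _ _)
      exact Def.forallElem (R := fun (w : List Bool) v (p : Fin (w.length + 1)) =>
        (Nat.testBit (v (z' (.tape b a'))) p = true ↔
          (b = φ.2.2 ∧ p = v (z .offset)) ∧ Mark M.blank (M.transition φ.1 σ a).2.1 a' ∨
          ¬ (b = φ.2.2 ∧ p = v (z .offset)) ∧ Nat.testBit (v (z (.tape b a'))) p = true))
        (((Def.testBit (.inl (z' (.tape b a'))) (.inr ())).iff
          ((hb.and (Def.const (Mark M.blank (M.transition φ.1 σ a).2.1 a'))).or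
            (hb.not.and (Def.testBit (.inl (z (.tape b a'))) (.inr ()))))).congr
              fun _ _ => Iff.rfl)

end StepDefinable

/-! ### The reduction from logarithmic space -/

namespace Machine

variable {M : Machine} {w : List Bool}

theorem run_succ (t : ℕ) : M.run w (t + 1) = M.step w (M.run w t) :=
  Function.iterate_succ_apply' _ _ _

theorem run_add_of_halted {t : ℕ} {b : Bool} (h : M.output (M.run w t).state = some b) (k : ℕ) :
    M.run w (t + k) = M.run w t := by
  induction k with
  | zero => rfl
  | succ k ih => rw [← add_assoc, run_succ, ih, step, h]

theorem inputPos_run_le (t : ℕ) : (M.run w t).inputPos ≤ w.length + 1 := by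
  induction t with
  | zero => exact Nat.zero_le _
  | succ t ih =>
    rw [run_succ, step]
    split
    · exact ih
    · exact min_le_right _ _

theorem work_run_of_le {B : ℕ} (hB : ∀ t, (M.run w t).workPos < B) {j : ℕ} (hj : B ≤ j) (t : ℕ) :
    (M.run w t).work j = M.blank := by
  induction t with
  | zero => rfl
  | succ t ih =>
    rw [run_succ, step]
    split
    · exact ih
    · have := hB t
      simp only
      rw [Function.update_of_ne (by omega), ih]

/-- Up to the first halting time, no configuration is repeated. -/
theorem run_injective {t₀ : ℕ} {b : Bool} (h₀ : M.output (M.run w t₀).state = some b)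
    (hlt : ∀ t < t₀, M.output (M.run w t).state = none) {t t' : ℕ} (htt : t < t') (ht' : t' ≤ t₀) :
    M.run w t ≠ M.run w t' := by
  intro h
  have hk : ∀ k, M.run w (t + k) = M.run w (t' + k) := by
    intro k
    induction k with
    | zero => exact h
    | succ k ih => rw [← add_assoc, ← add_assoc, run_succ, run_succ, ih]
  have h1 := hk (t₀ - t')
  rw [Nat.add_sub_cancel' ht'] at h1
  have h2 := hlt (t + (t₀ - t')) (by omega)
  rw [h1, h₀] at h2
  cases h2

end Machine

/-- A clock with `m ^ e` values: a chain of tuples in the covering relation of the lexicographic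
order, which starts at the zero tuple. -/
theorem exists_clock (m e : ℕ) (hm : 0 < m) :
    ∃ clock : ℕ → (Fin e → Fin m), (∀ j, (clock 0 j : ℕ) = 0) ∧
      ∀ t, t + 1 < m ^ e → toLex (clock t) ⋖ toLex (clock (t + 1)) := by
  classical
  let : Fintype (Lex (Fin e → Fin m)) := inferInstanceAs (Fintype (Fin e → Fin m))
  have hcard : Fintype.card (Lex (Fin e → Fin m)) = m ^ e := by
    change Fintype.card (Fin e → Fin m) = m ^ e
    simp
  let f := Fintype.orderIsoFinOfCardEq (Lex (Fin e → Fin m)) hcard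
  have hpos : 0 < m ^ e := Nat.pow_pos hm
  let i : ℕ → Fin (m ^ e) := fun t => if h : t < m ^ e then ⟨t, h⟩ else ⟨0, hpos⟩
  have hi : ∀ t, t < m ^ e → (i t : ℕ) = t := fun t h => by simp [i, h]
  refine ⟨fun t => ofLex (f (i t)), fun j => ?_, fun t ht => ?_⟩
  · have h0 : f (i 0) ≤ toLex fun _ => ⟨0, hm⟩ := by
      rw [← f.le_symm_apply]
      exact Fin.le_def.2 (by rw [hi 0 hpos]; exact Nat.zero_le _)
    have h1 : toLex (fun _ => ⟨0, hm⟩) ≤ f (i 0) :=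
      Pi.toLex_monotone (b := ofLex (f (i 0))) fun j => Fin.le_def.2 (Nat.zero_le _)
    change (ofLex (f (i 0)) j : ℕ) = 0
    rw [le_antisymm h0 h1]
    rfl
  · change f (i t) ⋖ f (i (t + 1))
    refine (apply_covBy_apply_iff f).2 ⟨Fin.lt_def.2 (by rw [hi _ ht, hi t (by omega)]; omega),
      fun x h1 h2 => ?_⟩
    have h1 := Fin.lt_def.1 h1
    have h2 := Fin.lt_def.1 h2
    rw [hi t (by omega)] at h1
    rw [hi _ ht] at h2
    omega

/-- The position of a tuple in the lexicographic order grades the covering relation. -/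
theorem exists_rank_lexCovBy (m e : ℕ) :
    ∃ rank : (Fin e → Fin m) → ℕ, ∀ u v, toLex u ⋖ toLex v → rank v = rank u + 1 := by
  let : Fintype (Lex (Fin e → Fin m)) := inferInstanceAs (Fintype (Fin e → Fin m))
  let f := Fintype.orderIsoFinOfCardEq (Lex (Fin e → Fin m)) rfl
  refine ⟨fun u => f.symm (toLex u), fun u v h => ?_⟩
  obtain ⟨h1, h2⟩ := (apply_covBy_apply_iff f.symm).2 h
  have h1 := Fin.lt_def.1 h1
  change (f.symm (toLex v) : ℕ) = f.symm (toLex u) + 1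
  by_contra hne
  exact h2 (c := ⟨f.symm (toLex u) + 1, by omega⟩) (Fin.lt_def.2 (by simp))
    (Fin.lt_def.2 (by simp only; omega))

/-- The factor `2` suffices because `log₂ (n + 1)` is at least one for nonempty words and at least
`log₂ n`. -/
theorem log_bound {n : ℕ} (hn : 1 ≤ n) (c : ℕ) :
    c * (Nat.log 2 n + 1) ≤ 2 * c * Nat.log 2 (n + 1) := by
  have h1 : Nat.log 2 n ≤ Nat.log 2 (n + 1) := Nat.log_mono_right (Nat.le_succ n)
  have h2 : 1 ≤ Nat.log 2 (n + 1) := Nat.log_pos one_lt_two (by omega)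
  calc c * (Nat.log 2 n + 1) ≤ c * (2 * Nat.log 2 (n + 1)) := Nat.mul_le_mul_left _ (by omega)
    _ = 2 * c * Nat.log 2 (n + 1) := by ring

/-- The vertices are pairs of an encoded configuration and a clock value. The clock makes the graph
acyclic; it runs long enough because no configuration occurs twice before the machine halts. -/
theorem detLHard_one : DetLHard 1 := by
  classical
  rintro A ⟨M, hdec, c, hlog⟩
  have hc : 0 < c := by
    rcases Nat.eq_zero_or_pos c with rfl | h
    · have := hlog [] 0
      simp at this
    · exact h
  let C := 2 * c
  have : NeZero C := ⟨by omega⟩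
  let e := Nat.card (CVar M C)
  let E : ∀ w : List Bool, (CVar M C ⊕ Fin e → Fin (w.length + 1)) →
      (CVar M C ⊕ Fin e → Fin (w.length + 1)) → Prop := fun w u v =>
    Step w (fun x => u (.inl x)) (fun x => v (.inl x)) ∧
      toLex (fun j => u (.inr j)) ⋖ toLex fun j => v (.inr j)
  let T : ∀ w : List Bool, (CVar M C ⊕ Fin e → Fin (w.length + 1)) → Prop := fun w u =>
    ∃ φ : Control M C, M.output φ.1 = some true ∧ IsControl (fun x => u (.inl x)) φ
  have hE : Def words fun w (v : (CVar M C ⊕ Fin e) ⊕ (CVar M C ⊕ Fin e) → Fin (w.length + 1)) =>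
      E w (v ∘ Sum.inl) (v ∘ Sum.inr) :=
    (def_step (fun x => Sum.inl (Sum.inl x)) fun x => Sum.inr (Sum.inl x)).and
      (Def.lexCovBy (fun j => Sum.inl (Sum.inr j)) fun j => Sum.inr (Sum.inr j))
  have hT : Def words T := Def.existsFin fun φ => (Def.const _).and (def_isControl φ _)
  have hs : Def words fun w (v : CVar M C ⊕ Fin e → Fin (w.length + 1)) => v = fun _ => 0 :=
    (Def.forallFin fun x => Def.isZero x).congr fun w v => by
      simp only [funext_iff, Fin.ext_iff, Fin.val_zero]
  have hfun : ∀ w : List Bool, 2 ≤ w.length + 1 → ∀ u v v', E w u v → E w u v' → v = v' := by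
    rintro w hw u v v' ⟨h1, h2⟩ ⟨h3, h4⟩
    have h5 := h1.unique hw h3
    have h6 := h2.unique_right h4
    funext x
    cases x with
    | inl x => exact congrFun h5 x
    | inr j => exact congrFun (toLex.injective h6) j
  obtain ⟨R, hR⟩ := exists_reduction_of_def (S := words) (fun w => Nat.succ_pos _) ([] ∈ A)
    hE hT hs hfun
    (fun w _ => by
      obtain ⟨rank, hr⟩ := exists_rank_lexCovBy (w.length + 1) e
      exact ⟨fun u => rank fun j => u (.inr j), fun u v h => hr _ _ h.2⟩)
    (by
      rintro w hw u v ⟨φ, hφ, hu⟩ ⟨⟨ψ, -, -, -, ⟨hn, -⟩, hψ, -⟩, -⟩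
      obtain rfl := hu.unique hw hψ
      rw [hφ] at hn
      cases hn)
  refine ⟨R, fun w => ⟨(hR w).1, ?_⟩⟩
  rcases Nat.lt_or_ge (w.length + 1) 2 with hw | hw
  -- The empty word has a universe with one element, and the answer for it is hardwired.
  · obtain rfl : w = [] := List.length_eq_zero_iff.1 (by omega)
    exact (hR []).2.1 rfl
  refine ((hR w).2.2 hw).trans ?_
  -- The first halting time and the answer.
  obtain ⟨t₀, b, hb, hbA, hlt⟩ : ∃ t₀ b, M.output (M.run w t₀).state = some b ∧
      (b = true ↔ w ∈ A) ∧ ∀ t < t₀, M.output (M.run w t).state = none := by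
    obtain ⟨t, b, hb⟩ := hdec w
    have hex : ∃ t b, M.output (M.run w t).state = some b ∧ (b = true ↔ w ∈ A) := ⟨t, b, hb⟩
    obtain ⟨b₀, h₀, h₁⟩ := Nat.find_spec hex
    refine ⟨Nat.find hex, b₀, h₀, h₁, fun t' ht' => ?_⟩
    by_contra hne
    obtain ⟨b', hb'⟩ := Option.ne_none_iff_exists'.1 hne
    obtain ⟨k, hk⟩ := Nat.exists_eq_add_of_lt ht'
    have h2 := Machine.run_add_of_halted hb' (k + 1)
    rw [← add_assoc, ← hk] at h2
    rw [h2, hb'] at h₀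
    exact Nat.find_min hex ht' ⟨b', hb', by rwa [Option.some_inj.1 h₀]⟩
  -- The encoded computation.
  have hB : ∀ t, (M.run w t).workPos < C * Nat.log 2 (w.length + 1) := fun t =>
    (hlog w t).trans_le (log_bound (by omega) c)
  have hz : ∀ t, ∃ z : CVar M C → Fin (w.length + 1), Encodes z (M.run w t) ∧
      (t = 0 → z = fun _ => 0) := by
    rintro (_ | t)
    · exact ⟨fun _ => 0, encodes_init fun _ => rfl, fun _ => rfl⟩
    · obtain ⟨z, hz⟩ := exists_encodes (C := C) (Nat.succ_pos _) (Machine.inputPos_run_le (t + 1))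
        (hB (t + 1)) fun j hj => Machine.work_run_of_le hB hj (t + 1)
      exact ⟨z, hz, by simp⟩
  choose z hz hz0 using hz
  obtain ⟨clock, hclock0, hclock⟩ := exists_clock (w.length + 1) e (Nat.succ_pos _)
  have hbound : t₀ < (w.length + 1) ^ e := by
    have hinj : Function.Injective fun t : Fin (t₀ + 1) => z t := by
      intro t t' h
      have h1 : M.run w t = M.run w t' :=
        (hz t).injective hw (by rw [show z t = z t' from h]; exact hz t')
      have h2 := t.isLt
      have h3 := t'.isLt
      rcases lt_trichotomy (t : ℕ) t' with h4 | h4 | h4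
      · exact (Machine.run_injective hb hlt h4 (by omega) h1).elim
      · exact Fin.ext h4
      · exact (Machine.run_injective hb hlt h4 (by omega) h1.symm).elim
    have h1 := Nat.card_le_card_of_injective _ hinj
    rw [Nat.card_fun, Nat.card_fin, Nat.card_fin] at h1
    exact h1
  let u : ℕ → (CVar M C ⊕ Fin e → Fin (w.length + 1)) := fun t => Sum.elim (z t) (clock t)
  have hu0 : u 0 = fun _ => 0 := by
    funext x
    cases x with
    | inl x => exact congrFun (hz0 0 rfl) x
    | inr j => exact Fin.ext (hclock0 j)
  have hstep : ∀ t < t₀, E w (u t) (u (t + 1)) := fun t ht =>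
    ⟨(hz t).step (Machine.run_succ (w := w) t ▸ hz (t + 1)) (hlt t ht), hclock t (by omega)⟩
  constructor
  · rintro ⟨v, ⟨φ, hφ, hv⟩, hreach⟩
    obtain ⟨t, ht, rfl⟩ : ∃ t ≤ t₀, v = u t := by
      clear hφ hv
      induction hreach with
      | refl => exact ⟨0, Nat.zero_le _, hu0.symm⟩
      | tail _ h ih =>
        obtain ⟨t, ht, rfl⟩ := ih
        rcases Nat.lt_or_eq_of_le ht with ht | rfl
        · exact ⟨t + 1, ht, hfun w hw _ _ _ h (hstep t ht)⟩
        · exact ((hz t).not_step hw (by rw [hb]; simp) h.1).elim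
    obtain ⟨ψ, hψ, hq, -⟩ := hz t
    obtain rfl : φ = ψ := IsControl.unique hw hv hψ
    rw [hq] at hφ
    rcases Nat.lt_or_eq_of_le ht with ht | rfl
    · rw [hlt t ht] at hφ
      cases hφ
    · rw [hb] at hφ
      exact hbA.1 (Option.some_inj.1 hφ)
  · intro hwA
    obtain ⟨φ, hφ, hq, -⟩ := hz t₀
    refine ⟨u t₀, ⟨φ, by rw [hq, hb, hbA.2 hwA], hφ⟩, ?_⟩
    have hreach : ∀ t ≤ t₀, Relation.ReflTransGen (E w) (fun _ => 0) (u t) := by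
      intro t
      induction t with
      | zero => intro _; rw [hu0]
      | succ t ih => exact fun ht => (ih (by omega)).tail (hstep t ht)
    exact hreach t₀ le_rfl

end BTDet

theorem mainTheorem9 (k : ℕ) (hk : 1 ≤ k) :
    BTDet.DetLHard k ∧ BTDet.OrdReducesToDet k := by
  refine ⟨fun A hA => ?_, ?_⟩
  · obtain ⟨R, hR⟩ := BTDet.detLHard_one A hA
    exact ⟨R, fun w => ⟨(hR w).1.trans hk, (hR w).2⟩⟩
  · obtain ⟨R, hR⟩ := BTDet.ordReducesToDet_one
    exact ⟨R, fun I => ⟨(hR I).1.trans hk, (hR I).2⟩⟩
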